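/- Let $F:\mathbb R^p\to\mathbb R^p$ be single-valued and $T:\mathbb R^p\rightrightarrows\mathbb R^p$ possibly multi-valued, and consider the inclusion $0\in Fx+Tx$. Assume: (i) there is a solution $x^\star$, i.e. $0\in Fx^\star+Tx^\star$; (ii) $Fx=\mathbb E_\xi[\mathbf F(x,\xi)]$ for a jointly measurable stochastic oracle $\mathbf F$, and for some $\sigma\ge 0$, $\mathbb E_\xi\|\mathbf F(x,\xi)-Fx\|^2\le\sigma^2$ for all $x$; (iii) $T$ is maximally $\rho$-co-hypomonotone for some $\rho\ge 0$: $\langle u-v,x-y\rangle\ge-\rho\|u-v\|^2$ for all $(x,u),(y,v)$ in the graph of $T$, and this graph is not properly contained in the graph of another operator with this property; (iv) there is $L>0$ with $\langle Fx-Fy,x-y\rangle\ge\frac1L\mathbb E_\xi\|\mathbf F(x,\xi)-\mathbf F(y,\xi)\|^2$ for all $x,y$. For $\lambda>0$ let $J_{\lambda T}x$ be the point $w$ with $x\in w+\lambda Tw$, and $G_\lambda x:=\frac1\lambda\big(x-J_{\lambda T}(x-\lambda Fx)\big)$. **Parameters.** Let $\hat L>L$ with $\hat L\rho<1$, and let $\lambda>0$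 with $2\rho\le\lambda<\frac{2(1+\sqrt{1-\hat L\rho})}{\hat L}$. Put $\bar\beta:=\frac{\lambda(4-\hat L\lambda)-4\rho}{4(1-\rho\hat L)}$ and $\Lambda:=\frac{\hat L-L}{L\hat L}$. Let $0<\mu<\frac23$, $r>3+\frac1\mu$, $\nu:=\frac\mu2$, $0<\beta\le\frac{(2-\mu)\bar\beta}{2+\mu}$, $t_k:=\mu(k+r)$ and $\eta_k:=\frac{2\beta(t_k-1)}{t_k-\nu}$. Let $x^0$ satisfy $Tx^0\ne\emptyset$, and let $\Psi_0\ge0$ be given by $$\Psi_0^2:=\mu^2r^2\|G_\lambda x^0\|^2+\frac{2r-1}{4\beta^2(\mu r-1)}\|x^0-x^\star\|^2 .$$ For $0<\epsilon\le\frac{\mu(r-3)-1}{\mu(r-1)-1}$ put $$b:=\max\Big\{1,\Big\lfloor\frac{c_b}{\epsilon}\Big\rfloor\Big\},\quad n:=\max\Big\{1,\Big\lfloor\frac{c_n}{\epsilon^3}\Big\rfloor\Big\},\quad \mathbf p_k:=\epsilon+\frac{2\mu}{\mu(k+r-1)-1},$$ with $c_b:=\frac{5\beta}{\mu\Lambda}$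 and $c_n:=24\sigma^2\max\big\{\frac{\sqrt2\,\Psi_0}{\mu^2},\frac1{\mu\beta}\big\}$. **Method (VFOSA$_+$ with the loopless SARAH estimator).** Set $z^0:=x^0$ and, for $k\ge0$, $$y^k:=\tfrac{t_k-1}{t_k}x^k+\tfrac1{t_k}z^k,\qquad x^{k+1}:=y^k-\tfrac{\eta_k}{\lambda}\big(x^k-J_{\lambda T}(x^k-\lambda\widetilde F^k)\big),\qquad z^{k+1}:=z^k+\nu(x^{k+1}-y^k).$$ Here $\widetilde F^0:=\frac1n\sum_{\xi\in\bar{\mathcal S}_0}\mathbf F(x^0,\xi)$, and for $k\ge1$ $$\widetilde F^k:=\begin{cases}\frac1n\sum_{\xi\in\bar{\mathcal S}_k}\mathbf F(x^k,\xi)&\text{with probability }\mathbf p_k,\\[1ex]\widetilde F^{k-1}+\frac1b\sum_{\xi\in\mathcal S_k}\big(\mathbf F(x^k,\xi)-\mathbf F(x^{k-1},\xi)\big)&\text{with probability }1-\mathbf p_k,\end{cases}$$ where $\bar{\mathcal S}_k$ and $\mathcal S_k$ are i.i.d. samples of $\xi$ of sizes $n$ and $b$, the switch at iteration $k$ is independent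 of these samples, and the randomness of different iterations is independent. **Claim.** There is a constant $C$, depending only on $\mu,r,\beta,\Lambda,\sigma$ and $\Psi_0$, such that for every such $\epsilon$ there is $K\ge0$ with $\mathbb E\|G_\lambda x^K\|^2\le\epsilon^2$ for which the expected total number of oracle calls $\mathbf F(\cdot,\xi)$ and evaluations of $J_{\lambda T}$ in the iterations $0,\dots,K$ is at most $$C\Big(\epsilon^{-2}+\epsilon^{-3}+\epsilon^{-3}\ln\frac1\epsilon\Big).$$ -/

import Mathlib

open MeasureTheory ProbabilityTheory

namespace VFOSA

/-- `ℝᵖ` with its standard inner product and Euclidean norm. -/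
abbrev Vec (p : ℕ) : Type := EuclideanSpace ℝ (Fin p)

/-- `T : ℝᵖ ⇉ ℝᵖ` is `ρ`-co-hypomonotone. -/
def CoHypomonotone {p : ℕ} (ρ : ℝ) (T : Vec p → Set (Vec p)) : Prop :=
  ∀ x y : Vec p, ∀ u ∈ T x, ∀ v ∈ T y, -ρ * ‖u - v‖ ^ 2 ≤ inner ℝ (u - v) (x - y)

/-- `T` is maximally `ρ`-co-hypomonotone: its graph is not properly contained in the graph of
another `ρ`-co-hypomonotone operator. -/
def MaxCoHypomonotone {p : ℕ} (ρ : ℝ) (T : Vec p → Set (Vec p)) : Prop :=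
  CoHypomonotone ρ T ∧
    ∀ S : Vec p → Set (Vec p), CoHypomonotone ρ S → (∀ x, T x ⊆ S x) → S = T

/-- `zer Φ` for `Φ = F + T`: the points `x` with `0 ∈ F x + T x`. -/
def zer {p : ℕ} (F : Vec p → Vec p) (T : Vec p → Set (Vec p)) : Set (Vec p) :=
  {x | ∃ u ∈ T x, F x + u = 0}

/-- The resolvent `J_{λT} x`: the point `w` with `x ∈ w + λ T w` (which exists and is unique when
`T` is maximally `ρ`-co-hypomonotone and `λ > ρ`). -/
noncomputable def resolvent {p : ℕ} (T : Vec p → Set (Vec p)) (lam : ℝ) (x : Vec p) : Vec p :=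
  Classical.epsilon fun w : Vec p => ∃ u ∈ T w, x = w + lam • u

/-- The forward-backward residual with forward value `f` in place of `F x`:
`(1/λ) (x - J_{λT}(x - λ f))`. -/
noncomputable def residual {p : ℕ} (T : Vec p → Set (Vec p)) (lam : ℝ) (x f : Vec p) : Vec p :=
  lam⁻¹ • (x - resolvent T lam (x - lam • f))

/-- The forward-backward splitting residual mapping `G_λ`. -/
noncomputable def G {p : ℕ} (F : Vec p → Vec p) (T : Vec p → Set (Vec p)) (lam : ℝ)
    (x : Vec p) : Vec p :=
  residual T lam x (F x)

/-- The standing assumptions on the inclusion `0 ∈ F x + T x` in the expectation setting. Here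
`D` is the law of `ξ` and `Fo x ξ` is the stochastic oracle of `F`. -/
structure IsProblem {p : ℕ} {Ξ : Type*} [MeasurableSpace Ξ] (D : Measure Ξ)
    (Fo : Vec p → Ξ → Vec p) (F : Vec p → Vec p) (T : Vec p → Set (Vec p))
    (σ L ρ : ℝ) : Prop where
  measurable_oracle : Measurable (Function.uncurry Fo)
  memLp_oracle : ∀ x, MemLp (Fo x) 2 D
  unbiased : ∀ x, F x = ∫ ξ, Fo x ξ ∂D
  sigma_nonneg : 0 ≤ σ
  variance_le : ∀ x, ∫ ξ, ‖Fo x ξ - F x‖ ^ 2 ∂D ≤ σ ^ 2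
  L_pos : 0 < L
  cocoercive : ∀ x y,
    (1 / L) * ∫ ξ, ‖Fo x ξ - Fo y ξ‖ ^ 2 ∂D ≤ inner ℝ (F x - F y) (x - y)
  rho_nonneg : 0 ≤ ρ
  maxCoHypomonotone : MaxCoHypomonotone ρ T

/-- The constant `β̄`. -/
noncomputable def betaBar (Lhat ρ lam : ℝ) : ℝ :=
  (lam * (4 - Lhat * lam) - 4 * ρ) / (4 * (1 - ρ * Lhat))

/-- The constant `Λ`. -/
noncomputable def Lam (L Lhat : ℝ) : ℝ := (Lhat - L) / (L * Lhat)

/-- The admissible ranges of the parameters `L̂`, `λ`, `μ`, `r`, `β`. -/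
structure AdmissibleParams (L Lhat ρ lam μ r β : ℝ) : Prop where
  L_lt : L < Lhat
  Lhat_mul_rho_lt : Lhat * ρ < 1
  lam_pos : 0 < lam
  two_rho_le : 2 * ρ ≤ lam
  lam_lt : lam < 2 * (1 + √(1 - Lhat * ρ)) / Lhat
  mu_pos : 0 < μ
  mu_lt : μ < 2 / 3
  r_gt : 3 + 1 / μ < r
  beta_pos : 0 < β
  beta_le : β ≤ (2 - μ) * betaBar Lhat ρ lam / (2 + μ)

/-- `t_k = μ (k + r)`. -/
noncomputable def tSeq (μ r : ℝ) (k : ℕ) : ℝ := μ * (k + r)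

/-- `η_k = 2 β (t_k - 1) / (t_k - ν)` with `ν = μ / 2`. -/
noncomputable def etaSeq (μ r β : ℝ) (k : ℕ) : ℝ :=
  2 * β * (tSeq μ r k - 1) / (tSeq μ r k - μ / 2)

/-- `Ψ₀`, the nonnegative square root of
`μ² r² ‖G_λ x⁰‖² + (2r - 1) / (4 β² (μ r - 1)) ‖x⁰ - x⋆‖²`. -/
noncomputable def Psi0 {p : ℕ} (F : Vec p → Vec p) (T : Vec p → Set (Vec p))
    (lam μ r β : ℝ) (x0 xstar : Vec p) : ℝ :=
  √(μ ^ 2 * r ^ 2 * ‖G F T lam x0‖ ^ 2 +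
    (2 * r - 1) / (4 * β ^ 2 * (μ * r - 1)) * ‖x0 - xstar‖ ^ 2)

/-- The sample average `F(x, S) = (1/m) ∑_{ξ ∈ S} F(x, ξ)` over a sample `S` of size `m`. -/
noncomputable def batchMean {p : ℕ} {Ξ : Type*} (Fo : Vec p → Ξ → Vec p) {m : ℕ}
    (S : Fin m → Ξ) (x : Vec p) : Vec p :=
  (m : ℝ)⁻¹ • ∑ i, Fo x (S i)

/-- The state `(xᵏ, zᵏ, F̃ᵏ)` of the method at iteration `k`. -/
structure State (p : ℕ) where
  x : Vec p
  z : Vec p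
  Fest : Vec p

/-- One run of VFOSA₊ with the loopless SARAH estimator, for given realizations of the random
switches `sw k`, the mini-batches `S k` and the mega-batches `Sbar k`. -/
noncomputable def run {p : ℕ} {Ξ : Type*} (Fo : Vec p → Ξ → Vec p) (T : Vec p → Set (Vec p))
    (lam μ r β : ℝ) (x0 : Vec p) {b n : ℕ}
    (sw : ℕ → Bool) (S : ℕ → Fin b → Ξ) (Sbar : ℕ → Fin n → Ξ) : ℕ → State p
  | 0 => ⟨x0, x0, batchMean Fo (Sbar 0) x0⟩
  | k + 1 =>
    let s := run Fo T lam μ r β x0 sw S Sbar k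
    let t := tSeq μ r k
    let y := ((t - 1) / t) • s.x + (1 / t) • s.z
    let x' := y - etaSeq μ r β k • residual T lam s.x s.Fest
    let z' := s.z + (μ / 2) • (x' - y)
    ⟨x', z',
      if sw (k + 1) = true then batchMean Fo (Sbar (k + 1)) x'
      else s.Fest + batchMean Fo (S (k + 1)) x' - batchMean Fo (S (k + 1)) s.x⟩

/-- The number of oracle calls `F(·, ξ)` that form `F̃ᵏ`: a mega-batch of size `n` at `k = 0` and
whenever the switch is on, and otherwise a mini-batch of size `b` evaluated at two points. -/
def oracleCalls (b n : ℕ) (sw : ℕ → Bool) (k : ℕ) : ℕ :=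
  if k = 0 ∨ sw k = true then n else 2 * b

/-- The number of oracle calls and resolvent evaluations in the iterations `0, …, K`, with one
evaluation of `J_{λT}` per iteration (`xᴷ` itself is available once iteration `K - 1` is done). -/
def totalCalls (b n : ℕ) (sw : ℕ → Bool) (K : ℕ) : ℕ :=
  ∑ k ∈ Finset.range (K + 1), (oracleCalls b n sw k + 1)

/-- The switching probability `p_k`. -/
noncomputable def switchProb (μ r ε : ℝ) (k : ℕ) : ℝ :=
  ε + 2 * μ / (μ * (k + r - 1) - 1)

/-- The randomness of the method: for each `k`, `S k` is an i.i.d. sample of `D` of size `b`,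
`Sbar k` is an i.i.d. sample of `D` of size `n`, the switch `sw k` is on with probability `pr k`
and is independent of both samples, and different iterations are independent. -/
structure IsSampling {Ω Ξ : Type*} [MeasurableSpace Ω] [MeasurableSpace Ξ]
    (P : Measure Ω) (D : Measure Ξ) (pr : ℕ → ℝ) {b n : ℕ}
    (sw : ℕ → Ω → Bool) (S : ℕ → Fin b → Ω → Ξ) (Sbar : ℕ → Fin n → Ω → Ξ) : Prop where
  measurable_sw : ∀ k, Measurable (sw k)
  measurable_S : ∀ k i, Measurable (S k i)
  measurable_Sbar : ∀ k j, Measurable (Sbar k j)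
  prob_sw : ∀ k, 1 ≤ k → P {ω | sw k ω = true} = ENNReal.ofReal (pr k)
  law_S : ∀ k i, P.map (S k i) = D
  law_Sbar : ∀ k j, P.map (Sbar k j) = D
  indep_S : ∀ k, iIndepFun (S k) P
  indep_Sbar : ∀ k, iIndepFun (Sbar k) P
  indep_sw : ∀ k, IndepFun (sw k) (fun ω => ((fun i => S k i ω), (fun j => Sbar k j ω))) P
  indep_steps :
    iIndepFun (fun (k : ℕ) ω => (sw k ω, (fun i => S k i ω), (fun j => Sbar k j ω))) P

/-- `c_b = 5 β / (μ Λ)`. -/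
noncomputable def cb (μ β Λ : ℝ) : ℝ := 5 * β / (μ * Λ)

/-- `c_n = 24 σ² max {√2 Ψ₀ / μ², 1 / (μ β)}`. -/
noncomputable def cn (μ β σ Ψ : ℝ) : ℝ :=
  24 * σ ^ 2 * max (√2 * Ψ / μ ^ 2) (1 / (μ * β))

/-- The mini-batch size `⌊c_b / ε⌋`, but at least `1`. -/
noncomputable def miniBatchSize (μ β Λ ε : ℝ) : ℕ := max 1 ⌊cb μ β Λ / ε⌋₊

/-- The mega-batch size `⌊c_n / ε³⌋`, but at least `1`. -/
noncomputable def megaBatchSize (μ β σ Ψ ε : ℝ) : ℕ := max 1 ⌊cn μ β σ Ψ / ε ^ 3⌋₊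

end VFOSA

/-!
The method decreases, in expectation and up to the estimation error, the Lyapunov function `lyap`
in the residual `G x`, the lag `x - z` and the distance `z - x⋆`. Three facts carry the proof.

* *Cocoercivity* (`IsProblem.G_cocoercive`). The resolvent of `T` is everywhere defined by Minty's
  theorem (`MaxCoHypomonotone.exists_resolvent`) and nonexpansive, and `G` is `β̄`-cocoercive with a
  surplus `Λ E_ξ ‖F(x, ξ) - F(y, ξ)‖²`. Here Minty's theorem is finite dimensional: finitely many
  pairs are handled by maximising a concave quadratic over a simplex, and arbitrary families by
  compactness of balls.

* *Descent* (`lyap_step`). Multiplying the cocoercivity inequality between `xᵏ` and `xᵏ⁺¹` by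
  `t_k (t_k - 1)` makes the terms `⟨G xᵏ, xᵏ - zᵏ⟩` telescope. Young's inequality absorbs the
  perturbation of the residual, at the price of `(5 β / (2 μ)) t_k (t_k - 1) ‖F̃ᵏ - F xᵏ‖²`; the gap
  between `β` and `β̄` pays for its product with `G xᵏ⁺¹ - G xᵏ`. The Lyapunov function dominates
  `t_{k-1}² ‖G xᵏ‖²` (`le_lyap`).

* *Variance reduction* (`IsProblem.estimator_error_succ`). The mean-squared error `Δ_k` of the
  estimator satisfies
  `Δ_{k+1} ≤ p_{k+1} σ² / n + (1 - p_{k+1}) (Δ_k + E ‖F(xᵏ⁺¹, ξ) - F(xᵏ, ξ)‖² / b)`, because the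
  state at iteration `k` is independent of the samples at iteration `k + 1`.

Adding to the Lyapunov function a multiple of `t_{k-1} (t_{k-1} - 1) / ε` times the excess of `Δ_k`
over `σ² / n` (`AdmissibleParams.lyap_sum_le`), the oracle differences are absorbed by the surplus in
the cocoercivity, thanks to `b ≥ c_b / (2 ε)`, and only the floor `σ² / n` is summed up. Hence
`E ‖G xᴷ‖²` is at most a constant times `Ψ₀² / (μ (K + r - 1))²` plus a constant times
`K σ² / (μ n)`. With `n ≥ c_n / (2 ε³)` this is at most `ε²` for the first `K` with
`K + r - 1 ≥ 2 Ψ₀ / (μ ε)`. Since `K = O(1 / ε)` and `∑ p_k ≤ ε K + 2 (1 + ln K)`, the expected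
number of calls is `O(b K + n (1 + ∑ p_k))`, which is the claim.
-/

namespace VFOSA

/-! ### Resolvents of maximally co-hypomonotone operators -/

section Minty

variable {E : Type*} [NormedAddCommGroup E] [InnerProductSpace ℝ E]

/-- Finitely many monotonically related pairs `(xᵢ, uᵢ)` admit a common `w` such that `(w, -w)` is
monotonically related to all of them. With `qᵢ = xᵢ - uᵢ`, one may take `w = ½ ∑ lᵢ qᵢ`, where `l`
maximises the dual function `l ↦ -¼ ‖∑ lᵢ qᵢ‖² - ∑ lᵢ ⟨xᵢ, uᵢ⟩` over the simplex. -/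
theorem exists_monotone_related_finset {ι : Type*} (s : Finset ι) (x u : ι → E)
    (hmono : ∀ i j, 0 ≤ inner ℝ (x i - x j) (u i - u j)) :
    ∃ w : E, ∀ i ∈ s, 0 ≤ inner ℝ (x i - w) (u i + w) := by
  classical
  rcases s.eq_empty_or_nonempty with rfl | ⟨i0, hi0⟩
  · exact ⟨0, by simp⟩
  set q : ι → E := fun i => x i - u i with hq
  set c : ι → ℝ := fun i => inner ℝ (x i) (u i) with hc
  let Q : (s → ℝ) → E := fun l => ∑ i, l i • q i
  let c' : (s → ℝ) → ℝ := fun l => ∑ i, l i * c i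
  let f : (s → ℝ) → ℝ := fun l => -‖Q l‖ ^ 2 / 4 - c' l
  have hf : Continuous f := by fun_prop
  have hne : (stdSimplex ℝ s).Nonempty := ⟨_, single_mem_stdSimplex ℝ (⟨i0, hi0⟩ : s)⟩
  obtain ⟨l, hl, hmax⟩ := (isCompact_stdSimplex ℝ s).exists_isMaxOn hne hf.continuousOn
  have hopt : ∀ i : s, c' l - inner ℝ (Q l) (q i - Q l) / 2 ≤ c i := by
    intro i
    have key : ∀ a : ℝ, 0 < a → a ≤ 1 →
        -inner ℝ (Q l) (q i - Q l) / 2 - (c i - c' l) ≤ a * (‖q i - Q l‖ ^ 2 / 4) := by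
      intro a ha ha1
      have hmem : (1 - a) • l + a • Pi.single i (1 : ℝ) ∈ stdSimplex ℝ s :=
        convex_stdSimplex ℝ s hl (single_mem_stdSimplex ℝ i) (by linarith) ha.le (by ring)
      have h1 : f ((1 - a) • l + a • Pi.single i (1 : ℝ)) ≤ f l := hmax hmem
      have hQ : Q ((1 - a) • l + a • Pi.single i (1 : ℝ)) = Q l + a • (q i - Q l) := by
        simp only [Q, Pi.add_apply, Pi.smul_apply, smul_eq_mul, add_smul, mul_smul,
          Finset.sum_add_distrib, ← Finset.smul_sum, Pi.single_apply, ite_smul, one_smul,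
          zero_smul, Finset.sum_ite_eq', Finset.mem_univ, if_true]
        module
      have hcc : c' ((1 - a) • l + a • Pi.single i (1 : ℝ)) = c' l + a * (c i - c' l) := by
        simp only [c', Pi.add_apply, Pi.smul_apply, smul_eq_mul, add_mul, mul_assoc,
          Finset.sum_add_distrib, ← Finset.mul_sum, Pi.single_apply, ite_mul, one_mul,
          zero_mul, Finset.sum_ite_eq', Finset.mem_univ, if_true]
        ring
      simp only [f, hQ, hcc] at h1
      rw [norm_add_sq_real, inner_smul_right, norm_smul, mul_pow, Real.norm_eq_abs, sq_abs] at h1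
      have : a * (-inner ℝ (Q l) (q i - Q l) / 2 - (c i - c' l)) ≤
          a * (a * (‖q i - Q l‖ ^ 2 / 4)) := by linarith
      exact le_of_mul_le_mul_left this ha
    by_contra! hlt
    -- A small step towards the vertex `i` would increase the dual function.
    set g := -inner ℝ (Q l) (q i - Q l) / 2 - (c i - c' l) with hg
    have hgpos : 0 < g := by rw [hg]; linarith
    have hB : 0 ≤ ‖q i - Q l‖ ^ 2 / 4 := by positivity
    set B := ‖q i - Q l‖ ^ 2 / 4
    have h2 := key (g / (2 * (g + B))) (by positivity) (by
      rw [div_le_one (by positivity)]; linarith)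
    rw [div_mul_eq_mul_div, le_div_iff₀ (by positivity)] at h2
    nlinarith [mul_nonneg hgpos.le hB]
  have hsum : ∑ i, l i = 1 := hl.2
  set X : E := ∑ i, l i • x i with hX
  set U : E := ∑ i, l i • u i with hU
  have hQXU : Q l = X - U := by
    simp only [Q, hq, hX, hU, smul_sub, Finset.sum_sub_distrib]
  have hcXU : inner ℝ X U ≤ c' l := by
    have h0 : 0 ≤ ∑ i, l i * ∑ j, l j * inner ℝ (x i - x j) (u i - u j) :=
      Finset.sum_nonneg fun i _ => mul_nonneg (hl.1 i)
        (Finset.sum_nonneg fun j _ => mul_nonneg (hl.1 j) (hmono _ _))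
    have h1 : ∀ i : s, ∑ j, l j * inner ℝ (x i - x j) (u i - u j) =
        c i - inner ℝ (x i) U - inner ℝ X (u i) + c' l := by
      intro i
      simp only [inner_sub_left, inner_sub_right, mul_sub, Finset.sum_sub_distrib, hX, hU,
        inner_sum, sum_inner, inner_smul_left, inner_smul_right, ← Finset.sum_mul, hsum, c', hc]
      simp
      ring
    simp only [h1, mul_add, mul_sub, Finset.sum_add_distrib, Finset.sum_sub_distrib,
      ← Finset.sum_mul, hsum, one_mul] at h0
    have h2 : ∑ i, l i * inner ℝ (x i) U = inner ℝ X U := by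
      simp [hX, sum_inner, inner_smul_left]
    have h3 : ∑ i, l i * inner ℝ X (u i) = inner ℝ X U := by
      rw [hU, inner_sum]; simp [inner_smul_right]
    have h4 : ∑ i, l i * c i = c' l := rfl
    rw [h2, h3, h4] at h0
    linarith
  refine ⟨(1 / 2 : ℝ) • Q l, fun i hi => ?_⟩
  have h1 := hopt ⟨i, hi⟩
  have h2 : inner ℝ (x i - (1 / 2 : ℝ) • Q l) (u i + (1 / 2 : ℝ) • Q l) =
      c i + inner ℝ (Q l) (q i) / 2 - ‖Q l‖ ^ 2 / 4 := by
    simp only [hc, hq, inner_sub_left, inner_sub_right, inner_add_right, inner_smul_left,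
      inner_smul_right, real_inner_self_eq_norm_sq, real_inner_comm (Q l) (x i)]
    simp
    ring
  have h3 : ‖Q l‖ ^ 2 = ‖X‖ ^ 2 - 2 * inner ℝ X U + ‖U‖ ^ 2 := by
    rw [hQXU, norm_sub_sq_real]
  have h4 : 0 ≤ ‖X‖ ^ 2 + 2 * inner ℝ X U + ‖U‖ ^ 2 := by
    rw [← norm_add_sq_real]; positivity
  rw [inner_sub_right, real_inner_self_eq_norm_sq] at h1
  simp only at h1
  rw [h2]
  linarith

/-- The set of `w` for which `(w, -w)` is monotonically related to a given pair is compact: it is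
a ball. -/
theorem isCompact_monotone_related [FiniteDimensional ℝ E] (x u : E) :
    IsCompact {w : E | 0 ≤ inner ℝ (x - w) (u + w)} := by
  have : ProperSpace E := FiniteDimensional.proper ℝ E
  refine Metric.isCompact_of_isClosed_isBounded
    (isClosed_le continuous_const (by fun_prop)) ?_
  refine (Metric.isBounded_closedBall (x := (0 : E)) (r := 1 + ‖x - u‖ + ‖x‖ * ‖u‖)).subset ?_
  intro w hw
  have hw' : 0 ≤ inner ℝ x u + inner ℝ (x - u) w - ‖w‖ ^ 2 := by
    have : inner ℝ (x - w) (u + w) = inner ℝ x u + inner ℝ (x - u) w - ‖w‖ ^ 2 := by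
      simp only [inner_sub_left, inner_add_right, real_inner_self_eq_norm_sq,
        real_inner_comm w u]
      ring
    exact this ▸ hw
  have h1 := real_inner_le_norm x u
  have h2 := real_inner_le_norm (x - u) w
  rw [mem_closedBall_zero_iff]
  by_contra! hlt
  have h3 : 0 ≤ ‖x - u‖ := norm_nonneg _
  have h4 : 0 ≤ ‖x‖ * ‖u‖ := by positivity
  nlinarith [norm_nonneg w, mul_nonneg h4 (norm_nonneg w)]

/-- Any monotone family of pairs admits a `w` such that `(w, -w)` is monotonically related to all
of them. -/
theorem exists_monotone_related [FiniteDimensional ℝ E] {ι : Type*} (x u : ι → E)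
    (hmono : ∀ i j, 0 ≤ inner ℝ (x i - x j) (u i - u j)) :
    ∃ w : E, ∀ i, 0 ≤ inner ℝ (x i - w) (u i + w) := by
  rcases isEmpty_or_nonempty ι with h | ⟨⟨i0⟩⟩
  · exact ⟨0, fun i => h.elim i⟩
  have := (isCompact_monotone_related (x i0) (u i0)).inter_iInter_nonempty
    (fun i => {w : E | 0 ≤ inner ℝ (x i - w) (u i + w)})
    (fun i => (isCompact_monotone_related (x i) (u i)).isClosed) (by
      intro s
      classical
      obtain ⟨w, hw⟩ := exists_monotone_related_finset (insert i0 s) x u hmono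
      refine ⟨w, hw i0 (by simp), ?_⟩
      simp only [Set.mem_iInter]
      exact fun i hi => hw i (by simp [hi]))
  obtain ⟨w, -, hw⟩ := this
  exact ⟨w, fun i => by simpa using Set.mem_iInter.1 hw i⟩

end Minty

variable {p : ℕ} {T : Vec p → Set (Vec p)} {ρ lam : ℝ}

/-- Minty's theorem: the resolvent of a maximally `ρ`-co-hypomonotone operator is everywhere
defined when `λ > ρ`. It is the surjectivity of `(T⁻¹ + ρ I) + (λ - ρ) I`, where `T⁻¹ + ρ I` is
maximally monotone. -/
theorem MaxCoHypomonotone.exists_resolvent (hT : MaxCoHypomonotone ρ T) (hlam : ρ < lam)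
    (x : Vec p) : ∃ w, ∃ u ∈ T w, x = w + lam • u := by
  have hγ : 0 < lam - ρ := by linarith
  obtain ⟨u, hu⟩ := exists_monotone_related
    (ι := {q : Vec p × Vec p // q.2 ∈ T q.1}) (fun q => q.1.2)
    (fun q => (lam - ρ)⁻¹ • (q.1.1 + ρ • q.1.2 - x)) (by
      rintro ⟨⟨a, v⟩, hv⟩ ⟨⟨a', v'⟩, hv'⟩
      have h := hT.1 a a' v hv v' hv'
      simp only at h ⊢
      rw [← smul_sub, inner_smul_right]
      refine mul_nonneg (by positivity) ?_
      have : a + ρ • v - x - (a' + ρ • v' - x) = (a - a') + ρ • (v - v') := by module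
      rw [this, inner_add_right, inner_smul_right, real_inner_self_eq_norm_sq]
      linarith)
  have hrel : ∀ a, ∀ v ∈ T a, -ρ * ‖v - u‖ ^ 2 ≤ inner ℝ (v - u) (a - (x - lam • u)) := by
    intro a v hv
    have h := hu ⟨(a, v), hv⟩
    simp only at h
    have e : (lam - ρ)⁻¹ • (a + ρ • v - x) + u =
        (lam - ρ)⁻¹ • ((a - (x - lam • u)) + ρ • (v - u)) := by
      have : u = (lam - ρ)⁻¹ • ((lam - ρ) • u) := by
        rw [smul_smul, inv_mul_cancel₀ hγ.ne', one_smul]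
      nth_rw 1 [this]
      rw [← smul_add]
      congr 1
      module
    rw [e, inner_smul_right, inner_add_right, inner_smul_right, real_inner_self_eq_norm_sq] at h
    have := nonneg_of_mul_nonneg_right h (inv_pos.2 hγ)
    linarith
  let S' : Vec p → Set (Vec p) := fun y => T y ∪ {v | v = u ∧ y = x - lam • u}
  have hS : CoHypomonotone ρ S' := by
    rintro a a' v (hv | ⟨rfl, rfl⟩) v' (hv' | ⟨rfl, rfl⟩)
    · exact hT.1 a a' v hv v' hv'
    · exact hrel a v hv
    · have := hrel a' v' hv'
      rw [norm_sub_rev, ← neg_sub v', ← neg_sub a', inner_neg_neg]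
      exact this
    · simp
  have hST := hT.2 S' hS fun y => Set.subset_union_left
  refine ⟨x - lam • u, u, ?_, by module⟩
  rw [← hST]
  exact Or.inr ⟨rfl, rfl⟩

theorem CoHypomonotone.dist_le (hT : CoHypomonotone ρ T) (hlam : 0 < lam) (h2 : 2 * ρ ≤ lam)
    {w w' u u' : Vec p} (hu : u ∈ T w) (hu' : u' ∈ T w') :
    ‖w - w'‖ ≤ ‖(w + lam • u) - (w' + lam • u')‖ := by
  have h := hT w w' u hu u' hu'
  have e : (w + lam • u) - (w' + lam • u') = (w - w') + lam • (u - u') := by module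
  refine le_of_sq_le_sq ?_ (norm_nonneg _)
  rw [e, norm_add_sq_real, inner_smul_right, norm_smul, mul_pow, Real.norm_eq_abs, sq_abs,
    real_inner_comm]
  nlinarith [mul_le_mul_of_nonneg_left h hlam.le,
    mul_nonneg (mul_nonneg hlam.le (sub_nonneg.2 h2)) (sq_nonneg ‖u - u'‖)]

theorem MaxCoHypomonotone.resolvent_spec (hT : MaxCoHypomonotone ρ T) (hlam : ρ < lam)
    (x : Vec p) : ∃ u ∈ T (resolvent T lam x), x = resolvent T lam x + lam • u :=
  Classical.epsilon_spec (hT.exists_resolvent hlam x)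

theorem MaxCoHypomonotone.resolvent_nonexpansive (hT : MaxCoHypomonotone ρ T) (hlam : 0 < lam)
    (h1 : ρ < lam) (h2 : 2 * ρ ≤ lam) (x y : Vec p) :
    ‖resolvent T lam x - resolvent T lam y‖ ≤ ‖x - y‖ := by
  obtain ⟨u, hu, hxu⟩ := hT.resolvent_spec h1 x
  obtain ⟨v, hv, hyv⟩ := hT.resolvent_spec h1 y
  have := hT.1.dist_le hlam h2 hu hv
  rwa [← hxu, ← hyv] at this

theorem MaxCoHypomonotone.resolvent_eq (hT : MaxCoHypomonotone ρ T) (hlam : 0 < lam)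
    (h1 : ρ < lam) (h2 : 2 * ρ ≤ lam) {x u : Vec p} (hu : u ∈ T x) :
    resolvent T lam (x + lam • u) = x := by
  obtain ⟨v, hv, hyv⟩ := hT.resolvent_spec h1 (x + lam • u)
  have := hT.1.dist_le hlam h2 hv hu
  rw [← hyv, sub_self, norm_zero] at this
  exact sub_eq_zero.1 (norm_le_zero_iff.1 this)

/-! ### Cocoercivity of the forward-backward residual -/

/-- The mean-squared oracle difference `E_ξ ‖F(x, ξ) - F(y, ξ)‖²`. -/
noncomputable def oracleGap {p : ℕ} {Ξ : Type*} [MeasurableSpace Ξ] (D : Measure Ξ)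
    (Fo : Vec p → Ξ → Vec p) (x y : Vec p) : ℝ :=
  ∫ ξ, ‖Fo x ξ - Fo y ξ‖ ^ 2 ∂D

theorem oracleGap_nonneg {p : ℕ} {Ξ : Type*} [MeasurableSpace Ξ] (D : Measure Ξ)
    (Fo : Vec p → Ξ → Vec p) (x y : Vec p) : 0 ≤ oracleGap D Fo x y :=
  integral_nonneg fun _ => by positivity

theorem integrable_norm_sq {α E : Type*} [MeasurableSpace α] [NormedAddCommGroup E]
    {P : Measure α} {f : α → E} (hf : MemLp f 2 P) : Integrable (fun a => ‖f a‖ ^ 2) P := by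
  simpa using hf.integrable_norm_pow (by norm_num)

theorem integrable_inner_of_memLp {α E : Type*} [MeasurableSpace α] [NormedAddCommGroup E]
    [InnerProductSpace ℝ E] {P : Measure α} {f g : α → E} (hf : MemLp f 2 P) (hg : MemLp g 2 P) :
    Integrable (fun a => inner ℝ (f a) (g a)) P := by
  refine ((integrable_norm_sq hf).add (integrable_norm_sq hg)).mono'
    (hf.1.inner hg.1) (.of_forall fun a => ?_)
  have := norm_inner_le_norm (𝕜 := ℝ) (f a) (g a)
  simp only [Pi.add_apply]
  nlinarith [sq_nonneg (‖f a‖ - ‖g a‖), sq_nonneg (‖f a‖), sq_nonneg ‖g a‖]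

theorem integral_norm_sub_integral_sq {α E : Type*} [MeasurableSpace α] [NormedAddCommGroup E]
    [InnerProductSpace ℝ E] [CompleteSpace E] {P : Measure α} [IsProbabilityMeasure P] {f : α → E}
    (hf : MemLp f 2 P) :
    ∫ a, ‖f a - ∫ b, f b ∂P‖ ^ 2 ∂P = ∫ a, ‖f a‖ ^ 2 ∂P - ‖∫ a, f a ∂P‖ ^ 2 := by
  set m := ∫ b, f b ∂P with hm
  have h1 := integrable_norm_sq hf
  have h2 : Integrable f P := hf.integrable (by norm_num)
  have h3 : ∫ a, inner ℝ (f a) m ∂P = ‖m‖ ^ 2 := by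
    simp_rw [real_inner_comm m]
    rw [integral_inner h2, ← hm, real_inner_self_eq_norm_sq]
  have h4 : Integrable (fun a => 2 * inner ℝ (f a) m) P := (h2.inner_const m).const_mul 2
  calc ∫ a, ‖f a - m‖ ^ 2 ∂P = ∫ a, ((‖f a‖ ^ 2 - 2 * inner ℝ (f a) m) + ‖m‖ ^ 2) ∂P := by
        simp_rw [norm_sub_sq_real]
    _ = ∫ a, (‖f a‖ ^ 2 - 2 * inner ℝ (f a) m) ∂P + ∫ _, ‖m‖ ^ 2 ∂P :=
        integral_add (h1.sub h4) (integrable_const _)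
    _ = _ := by
        rw [integral_sub h1 h4, integral_const_mul, h3]
        simp
        ring

section Problem

variable {p : ℕ} {Ξ : Type*} [MeasurableSpace Ξ] {D : Measure Ξ}
  {Fo : Vec p → Ξ → Vec p} {F : Vec p → Vec p} {T : Vec p → Set (Vec p)}
  {σ L Lhat ρ lam μ r β : ℝ}

theorem AdmissibleParams.rho_lt_lam (hA : AdmissibleParams L Lhat ρ lam μ r β) :
    ρ < lam := by
  have := hA.lam_pos
  have := hA.two_rho_le
  linarith

/-- The restriction on `β` says that `β̄` exceeds `β` by the factor `(1 + ν) / (1 - ν)`. -/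
theorem AdmissibleParams.le_betaBar (hA : AdmissibleParams L Lhat ρ lam μ r β) :
    β * (1 + μ / 2) / (1 - μ / 2) ≤ betaBar Lhat ρ lam := by
  have h1 := hA.mu_pos
  have h2 := hA.mu_lt
  have h := hA.beta_le
  rw [le_div_iff₀ (by linarith)] at h
  rw [div_le_iff₀ (by linarith)]
  linarith

theorem AdmissibleParams.beta_le_betaBar (hA : AdmissibleParams L Lhat ρ lam μ r β) :
    β ≤ betaBar Lhat ρ lam := by
  refine le_trans ?_ hA.le_betaBar
  have h1 := hA.mu_pos
  have h2 := hA.mu_lt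
  have h3 := hA.beta_pos
  rw [le_div_iff₀ (by linarith)]
  nlinarith

theorem IsProblem.Lam_pos (hP : IsProblem D Fo F T σ L ρ)
    (hA : AdmissibleParams L Lhat ρ lam μ r β) : 0 < Lam L Lhat := by
  have h1 := hP.L_pos
  have h2 := hA.L_lt
  exact div_pos (by linarith) (mul_pos h1 (h1.trans h2))

/-- Jensen's inequality for the oracle differences. -/
theorem IsProblem.norm_sub_sq_le [IsProbabilityMeasure D] (hP : IsProblem D Fo F T σ L ρ) (x y : Vec p) :
    ‖F x - F y‖ ^ 2 ≤ oracleGap D Fo x y := by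
  have h := integral_norm_sub_integral_sq ((hP.memLp_oracle x).sub (hP.memLp_oracle y))
  have h0 : 0 ≤ ∫ a, ‖(Fo x - Fo y) a - ∫ b, (Fo x - Fo y) b ∂D‖ ^ 2 ∂D :=
    integral_nonneg fun _ => by positivity
  have h1 : ∫ b, (Fo x - Fo y) b ∂D = F x - F y := by
    rw [hP.unbiased x, hP.unbiased y]
    exact integral_sub ((hP.memLp_oracle x).integrable (by norm_num))
      ((hP.memLp_oracle y).integrable (by norm_num))
  rw [h, h1] at h0
  exact sub_nonneg.1 h0

theorem IsProblem.lipschitz [IsProbabilityMeasure D] (hP : IsProblem D Fo F T σ L ρ) (x y : Vec p) :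
    ‖F x - F y‖ ≤ L * ‖x - y‖ := by
  have h1 := hP.norm_sub_sq_le x y
  have h2 := hP.cocoercive x y
  have h3 := real_inner_le_norm (F x - F y) (x - y)
  have hL := hP.L_pos
  change 1 / L * oracleGap D Fo x y ≤ _ at h2
  rw [div_mul_eq_mul_div, one_mul, div_le_iff₀ hL] at h2
  by_contra! hlt
  have h4 : 0 < ‖F x - F y‖ := lt_of_le_of_lt (by positivity) hlt
  nlinarith [mul_lt_mul_of_pos_left hlt h4]

theorem IsProblem.oracleGap_le [IsProbabilityMeasure D] (hP : IsProblem D Fo F T σ L ρ) (x y : Vec p) :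
    oracleGap D Fo x y ≤ L ^ 2 * ‖x - y‖ ^ 2 := by
  have h2 := hP.cocoercive x y
  have h3 := real_inner_le_norm (F x - F y) (x - y)
  have hL := hP.L_pos
  change 1 / L * oracleGap D Fo x y ≤ _ at h2
  rw [div_mul_eq_mul_div, one_mul, div_le_iff₀ hL] at h2
  have h4 := mul_le_mul_of_nonneg_right (hP.lipschitz x y) (norm_nonneg (x - y))
  nlinarith

theorem IsProblem.continuous [IsProbabilityMeasure D] (hP : IsProblem D Fo F T σ L ρ) : Continuous F := by
  refine (LipschitzWith.of_dist_le_mul (K := L.toNNReal) fun x y => ?_).continuous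
  simpa [dist_eq_norm, hP.L_pos.le] using hP.lipschitz x y

theorem IsProblem.continuous_residual (hP : IsProblem D Fo F T σ L ρ)
    (hA : AdmissibleParams L Lhat ρ lam μ r β) :
    Continuous fun q : Vec p × Vec p => residual T lam q.1 q.2 := by
  have h : Continuous (resolvent T lam) := by
    refine (LipschitzWith.of_dist_le_mul (K := 1) fun x y => ?_).continuous
    simpa [dist_eq_norm] using hP.maxCoHypomonotone.resolvent_nonexpansive hA.lam_pos
      hA.rho_lt_lam hA.two_rho_le x y
  unfold residual
  fun_prop

/-- Replacing `F x` by `f` perturbs the residual by at most `‖f - F x‖`. -/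
theorem IsProblem.norm_residual_sub_le (hP : IsProblem D Fo F T σ L ρ)
    (hA : AdmissibleParams L Lhat ρ lam μ r β) (x f : Vec p) :
    ‖residual T lam x f - G F T lam x‖ ≤ ‖f - F x‖ := by
  have h := hP.maxCoHypomonotone.resolvent_nonexpansive hA.lam_pos
    hA.rho_lt_lam hA.two_rho_le (x - lam • F x) (x - lam • f)
  have e : x - lam • F x - (x - lam • f) = lam • (f - F x) := by module
  rw [e, norm_smul, Real.norm_of_nonneg hA.lam_pos.le] at h
  have e2 : residual T lam x f - G F T lam x =
      lam⁻¹ • (resolvent T lam (x - lam • F x) - resolvent T lam (x - lam • f)) := by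
    simp only [G, residual]; module
  rw [e2, norm_smul, Real.norm_of_nonneg (inv_nonneg.2 hA.lam_pos.le)]
  calc _ ≤ lam⁻¹ * (lam * ‖f - F x‖) := by gcongr; exact inv_nonneg.2 hA.lam_pos.le
    _ = _ := by rw [← mul_assoc, inv_mul_cancel₀ hA.lam_pos.ne', one_mul]

theorem IsProblem.G_eq_zero (hP : IsProblem D Fo F T σ L ρ)
    (hA : AdmissibleParams L Lhat ρ lam μ r β) {x : Vec p} (hx : x ∈ zer F T) :
    G F T lam x = 0 := by
  obtain ⟨u, hu, h0⟩ := hx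
  have := hP.maxCoHypomonotone.resolvent_eq hA.lam_pos
    hA.rho_lt_lam hA.two_rho_le hu
  rw [G, residual, eq_neg_of_add_eq_zero_left h0, smul_neg, sub_neg_eq_add, this, sub_self,
    smul_zero]

/-- The residual mapping is `β̄`-cocoercive, with a surplus of `Λ` times the mean-squared oracle
difference. The surplus is the part of the cocoercivity of `F` by which `1 / L` exceeds `1 / L̂`;
`β̄` comes from minimising over `F x - F y` in what remains. -/
theorem IsProblem.G_cocoercive [IsProbabilityMeasure D] (hP : IsProblem D Fo F T σ L ρ)
    (hA : AdmissibleParams L Lhat ρ lam μ r β) (x y : Vec p) :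
    betaBar Lhat ρ lam * ‖G F T lam x - G F T lam y‖ ^ 2 + Lam L Lhat * oracleGap D Fo x y ≤
      inner ℝ (G F T lam x - G F T lam y) (x - y) := by
  have hl := hA.lam_pos
  have hL := hP.L_pos
  have hLh : 0 < Lhat := hL.trans hA.L_lt
  have hk : 0 < 1 - ρ * Lhat := by have := hA.Lhat_mul_rho_lt; linarith
  have hk1 : 1 - Lhat * ρ ≠ 0 := by rw [mul_comm]; exact hk.ne'
  have hrl := hA.rho_lt_lam
  obtain ⟨u, hu, hxu⟩ := hP.maxCoHypomonotone.resolvent_spec hrl (x - lam • F x)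
  obtain ⟨v, hv, hyv⟩ := hP.maxCoHypomonotone.resolvent_spec hrl (y - lam • F y)
  have hT := hP.maxCoHypomonotone.1 _ _ u hu v hv
  have hGx : lam • G F T lam x = x - resolvent T lam (x - lam • F x) := by
    rw [G, residual, smul_smul, mul_inv_cancel₀ hl.ne', one_smul]
  have hGy : lam • G F T lam y = y - resolvent T lam (y - lam • F y) := by
    rw [G, residual, smul_smul, mul_inv_cancel₀ hl.ne', one_smul]
  set gx := G F T lam x
  set gy := G F T lam y
  set wx := resolvent T lam (x - lam • F x)
  set wy := resolvent T lam (y - lam • F y)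
  have hux : u = gx - F x := by
    refine smul_right_injective (Vec p) hl.ne' ?_
    simp only [smul_sub, hGx]
    rw [eq_sub_iff_add_eq, eq_sub_iff_add_eq, ← sub_eq_zero]
    have := sub_eq_zero.2 hxu
    rw [← neg_eq_zero, ← this]
    module
  have hvy : v = gy - F y := by
    refine smul_right_injective (Vec p) hl.ne' ?_
    simp only [smul_sub, hGy]
    rw [eq_sub_iff_add_eq, eq_sub_iff_add_eq, ← sub_eq_zero]
    have := sub_eq_zero.2 hyv
    rw [← neg_eq_zero, ← this]
    module
  have e1 : u - v = (gx - gy) - (F x - F y) := by rw [hux, hvy]; abel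
  have e2 : wx - wy = (x - y) - lam • (gx - gy) := by
    rw [smul_sub, hGx, hGy]; abel
  rw [e1, e2] at hT
  have hc := hP.cocoercive x y
  have hJ := hP.norm_sub_sq_le x y
  change 1 / L * oracleGap D Fo x y ≤ _ at hc
  set U := oracleGap D Fo x y
  set g := gx - gy
  set f := F x - F y
  set d := x - y
  have hLam : Lam L Lhat * U = 1 / L * U - 1 / Lhat * U := by
    unfold Lam; field_simp
  have h1 : inner ℝ (g - f) (d - lam • g) =
      inner ℝ g d - lam * ‖g‖ ^ 2 - inner ℝ f d + lam * inner ℝ g f := by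
    simp only [inner_sub_left, inner_sub_right, inner_smul_right, real_inner_self_eq_norm_sq,
      real_inner_comm g f]
    ring
  rw [h1, norm_sub_sq_real] at hT
  have h2 : 1 / Lhat * ‖f‖ ^ 2 ≤ 1 / Lhat * U := by gcongr
  have h3 : 0 ≤ ‖(2 * (1 - ρ * Lhat)) • f - (Lhat * (lam - 2 * ρ)) • g‖ ^ 2 := by positivity
  rw [norm_sub_sq_real, norm_smul, norm_smul, inner_smul_left, inner_smul_right, mul_pow, mul_pow,
    Real.norm_eq_abs, Real.norm_eq_abs, sq_abs, sq_abs, real_inner_comm] at h3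
  simp only [conj_trivial] at h3
  have h4 : (lam - 2 * ρ) * inner ℝ g f ≤ (1 / Lhat - ρ) * ‖f‖ ^ 2 +
      Lhat * (lam - 2 * ρ) ^ 2 / (4 * (1 - ρ * Lhat)) * ‖g‖ ^ 2 := by
    rw [← sub_nonneg]
    have : (1 / Lhat - ρ) * ‖f‖ ^ 2 +
      Lhat * (lam - 2 * ρ) ^ 2 / (4 * (1 - ρ * Lhat)) * ‖g‖ ^ 2 - (lam - 2 * ρ) * inner ℝ g f =
      ((2 * (1 - ρ * Lhat)) ^ 2 * ‖f‖ ^ 2 - 2 * ((2 * (1 - ρ * Lhat)) *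
        ((Lhat * (lam - 2 * ρ)) * inner ℝ g f)) + (Lhat * (lam - 2 * ρ)) ^ 2 * ‖g‖ ^ 2) /
        (4 * (1 - ρ * Lhat) * Lhat) := by
      field_simp
      ring
    rw [this]
    positivity
  have h5 : betaBar Lhat ρ lam =
      lam - ρ - Lhat * (lam - 2 * ρ) ^ 2 / (4 * (1 - ρ * Lhat)) := by
    unfold betaBar
    field_simp
    ring
  rw [h5, hLam]
  linarith

end Problem

/-! ### The Lyapunov function -/

section Lyapunov

variable {E : Type*} [NormedAddCommGroup E] [InnerProductSpace ℝ E]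

/-- The Lyapunov function, at an iterate `(x, z)` with residual `g = G x`, solution `xs`, and
`τ = t_{k-1}` at iteration `k`; `ν = μ / 2`. With `η = 2 β (τ - 1) / (τ - ν)`, the last two weights
are `ν τ / ((1 - ν) (τ - 1) η)` and `1 / (2 ν η)`. -/
noncomputable def lyap (ν β τ : ℝ) (xs g x z : E) : ℝ :=
  β * (τ * (τ - 1)) * ‖g‖ ^ 2 + τ * inner ℝ g (x - z) +
    ν * τ * (τ - ν) / (2 * β * (1 - ν) * (τ - 1) ^ 2) * ‖x - z‖ ^ 2 +
    (τ - ν) / (4 * ν * β * (τ - 1)) * ‖z - xs‖ ^ 2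

/-- Young's inequality. -/
theorem neg_mul_inner_le {k : ℝ} (hk : 0 < k) (s : ℝ) (a b : E) :
    -s * inner ℝ a b ≤ k * ‖b‖ ^ 2 + s ^ 2 / (4 * k) * ‖a‖ ^ 2 := by
  have h : 0 ≤ ‖s • a + (2 * k) • b‖ ^ 2 := by positivity
  rw [norm_add_sq_real, norm_smul, norm_smul, inner_smul_left, inner_smul_right, mul_pow, mul_pow,
    Real.norm_eq_abs, Real.norm_eq_abs, sq_abs, sq_abs] at h
  simp only [conj_trivial] at h
  rw [← sub_nonneg]
  have : k * ‖b‖ ^ 2 + s ^ 2 / (4 * k) * ‖a‖ ^ 2 - -s * inner ℝ a b =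
      (s ^ 2 * ‖a‖ ^ 2 + 2 * (s * (2 * k * inner ℝ a b)) + (2 * k) ^ 2 * ‖b‖ ^ 2) / (4 * k) := by
    field_simp
    ring
  rw [this]
  positivity

/-- The Lyapunov function controls `τ² ‖g‖²`. -/
theorem le_lyap {ν β τ : ℝ} (hν : 0 < ν) (hν' : ν < 1 / 3) (hβ : 0 < β) (hτ : 1 < τ)
    {xs g x : E} (z : E) (hg : β * ‖g‖ ^ 2 ≤ inner ℝ g (x - xs)) :
    2 / 3 * β * τ ^ 2 * ‖g‖ ^ 2 ≤ lyap ν β τ xs g x z := by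
  have hτν : 0 < τ - ν := by linarith
  have hτ1 : 0 < τ - 1 := by linarith
  have hk : 0 < (τ - ν) / (4 * ν * β * (τ - 1)) := by positivity
  have h2 : (-τ) ^ 2 / (4 * ((τ - ν) / (4 * ν * β * (τ - 1)))) ≤ τ ^ 2 * β / 3 := by
    have : (-τ) ^ 2 / (4 * ((τ - ν) / (4 * ν * β * (τ - 1)))) =
        τ ^ 2 * β * (ν * ((τ - 1) / (τ - ν))) := by
      field_simp
    rw [this, mul_div_assoc]
    have h3 : (τ - 1) / (τ - ν) ≤ 1 := by rw [div_le_one hτν]; linarith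
    have h4 : 0 ≤ (τ - 1) / (τ - ν) := by positivity
    have h5 : ν * ((τ - 1) / (τ - ν)) ≤ 1 / 3 := by nlinarith
    rw [show τ ^ 2 * (β / 3) = τ ^ 2 * β * (1 / 3) by ring]
    gcongr
  have h3 : 0 ≤ ν * τ * (τ - ν) / (2 * β * (1 - ν) * (τ - 1) ^ 2) * ‖x - z‖ ^ 2 := by
    have : 0 < 1 - ν := by linarith
    positivity
  have h4 := mul_le_mul_of_nonneg_right h2 (sq_nonneg ‖g‖)
  have h1 := neg_mul_inner_le hk (-τ) g (z - xs)
  have h5 : inner ℝ g (x - z) = inner ℝ g (x - xs) - inner ℝ g (z - xs) := by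
    rw [← inner_sub_right]; congr 1; abel
  unfold lyap
  rw [h5, mul_sub τ (inner ℝ g (x - xs))]
  have h6 := mul_le_mul_of_nonneg_left hg (by linarith : 0 ≤ τ)
  rw [neg_sq] at h1 h4
  generalize (τ - ν) / (4 * ν * β * (τ - 1)) = c at *
  generalize τ ^ 2 / (4 * c) = c' at *
  nlinarith

/-- One step of the method, in terms of `t = t_k`, before the perturbation `e` of the residual is
estimated. The weight `t (t - 1)` of the cocoercivity inequality `hco` makes both
`t (x' - x)` and `(t - 1) (x' - x)` expressible through `x - z` and `x' - z'`; the weights of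
`‖x - z‖²` and `‖z - xs‖²` are such that the remaining terms in `g` combine to
`⟨g, x - xs⟩`. -/
theorem lyap_step_raw {ν β bb t LU : ℝ} (hν : 0 < ν) (hν' : ν < 1 / 3) (hβ : 0 < β)
    (ht : 1 < t) (hbb : β * (1 + ν) / (1 - ν) ≤ bb)
    {xs g g' e x z x' z' : E}
    (hx' : x' = ((t - 1) / t) • x + (1 / t) • z - (2 * β * (t - 1) / (t - ν)) • (g + e))
    (hz' : z' = z - (ν * (2 * β * (t - 1) / (t - ν))) • (g + e))
    (hco : bb * ‖g' - g‖ ^ 2 + LU ≤ inner ℝ (g' - g) (x' - x))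
    (hg : bb * ‖g‖ ^ 2 ≤ inner ℝ g (x - xs)) :
    lyap ν β t xs g' x' z' + t * (t - 1) * LU ≤
      (t - 2 * ν) * inner ℝ g (x - z) + (t - ν) / (4 * ν * β * (t - 1)) * ‖z - xs‖ ^ 2 +
      ν * (t - ν) / (2 * β * (1 - ν) * t) * ‖x - z‖ ^ 2 +
      (β * (t * (t - 1) * (t - 2 + ν) / (t - ν)) - bb +
        β * (ν * ((3 - 2 * ν) * t - 1) / (t - ν))) * ‖g‖ ^ 2 +
      (β * (ν * ((3 - 2 * ν) * t - 1) / (t - ν)) + β * (t * (t - 1)) * (1 - ν) / (2 * ν)) *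
        ‖e‖ ^ 2 +
      2 * β * (ν * ((3 - 2 * ν) * t - 1) / (t - ν) - (1 - ν) * (t * (t - 1) / (t - ν))) *
        inner ℝ g e -
      2 * ν * inner ℝ e (x - z) - inner ℝ e (z - xs) := by
  have h1ν : 0 < 1 - ν := by linarith
  have htν : 0 < t - ν := by linarith
  have ht1 : 0 < t - 1 := by linarith
  have ht0 : 0 < t := by linarith
  set η := 2 * β * (t - 1) / (t - ν) with hη
  have hη0 : 0 < η := by positivity
  -- The three expressions of the step through `x - z`, `x' - z'` and the residual.
  have d1 : t • (x' - x) = -(x - z) - (t * η) • (g + e) := by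
    rw [hx', div_eq_inv_mul, one_div, show x - z = t • (t⁻¹ • (x - z)) by
      rw [smul_smul, mul_inv_cancel₀ ht0.ne', one_smul], mul_smul, mul_smul, ← smul_neg,
      ← smul_sub]
    congr 1
    rw [sub_smul, one_smul, smul_sub, smul_smul, inv_mul_cancel₀ ht0.ne', one_smul, smul_sub]
    abel
  have hD : x' - z' = ((t - 1) / t) • (x - z) - ((1 - ν) * η) • (g + e) := by
    rw [hx', hz', show z - (ν * η) • (g + e) =
      (((t - 1) / t) • z + (1 / t) • z) - (ν * η) • (g + e) by
        rw [← add_smul, ← add_div, sub_add_cancel, div_self ht0.ne', one_smul]]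
    module
  have d2 : (t - 1) • (x' - x) = -(x' - z') - (2 * β * (t - 1)) • (g + e) := by
    have e1 : (t - 1) • (x' - x) = ((t - 1) / t) • (t • (x' - x)) := by
      rw [smul_smul, div_mul_cancel₀ _ ht0.ne']
    rw [e1, d1, hD, smul_sub, smul_smul, smul_neg, neg_sub]
    have e2 : (t - 1) / t * (t * η) = 2 * β * (t - 1) - (1 - ν) * η := by
      rw [hη]; field_simp; ring
    rw [e2]
    module
  have i1 : t * (t - 1) * inner ℝ g (x' - x) = (t - 1) * (-inner ℝ g (x - z)) -
      (t - 1) * (t * η) * (‖g‖ ^ 2 + inner ℝ g e) := by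
    rw [mul_right_comm, mul_comm _ (t - 1), ← inner_smul_right, d1, inner_sub_right,
      inner_neg_right, inner_smul_right, inner_add_right, real_inner_self_eq_norm_sq]
    ring
  have i2 : t * (t - 1) * inner ℝ g' (x' - x) = -t * inner ℝ g' (x' - z') -
      t * (2 * β * (t - 1)) * (inner ℝ g' g + inner ℝ g' e) := by
    rw [mul_assoc, ← inner_smul_right, d2, inner_sub_right, inner_neg_right, inner_smul_right,
      inner_add_right]
    ring
  have hDn : ν * t * (t - ν) / (2 * β * (1 - ν) * (t - 1) ^ 2) * ‖x' - z'‖ ^ 2 =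
      ν * (t - ν) / (2 * β * (1 - ν) * t) * ‖x - z‖ ^ 2 -
      2 * ν * (inner ℝ g (x - z) + inner ℝ e (x - z)) +
      β * (ν * (1 - ν) * (2 * t) / (t - ν)) * ‖g + e‖ ^ 2 := by
    rw [hD, norm_sub_sq_real, norm_smul, norm_smul, inner_smul_left, inner_smul_right, mul_pow,
      mul_pow, Real.norm_eq_abs, Real.norm_eq_abs, sq_abs, sq_abs, inner_add_right,
      real_inner_comm g, real_inner_comm e]
    simp only [conj_trivial]
    rw [hη]
    field_simp
  have hZn : (t - ν) / (4 * ν * β * (t - 1)) * ‖z' - xs‖ ^ 2 =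
      (t - ν) / (4 * ν * β * (t - 1)) * ‖z - xs‖ ^ 2 -
      (inner ℝ g (z - xs) + inner ℝ e (z - xs)) +
      β * (ν * (t - 1) / (t - ν)) * ‖g + e‖ ^ 2 := by
    rw [hz', show z - (ν * η) • (g + e) - xs = (z - xs) - (ν * η) • (g + e) by abel,
      norm_sub_sq_real, norm_smul, inner_smul_right, mul_pow, Real.norm_eq_abs, sq_abs,
      inner_add_right, real_inner_comm g, real_inner_comm e]
    rw [hη]
    field_simp
    ring
  have hN : ‖g + e‖ ^ 2 = ‖g‖ ^ 2 + 2 * inner ℝ g e + ‖e‖ ^ 2 := norm_add_sq_real g e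
  have hP : inner ℝ g' g = (‖g'‖ ^ 2 + ‖g‖ ^ 2 - ‖g' - g‖ ^ 2) / 2 := by
    rw [norm_sub_sq_real]; ring
  have hE : inner ℝ g' e = inner ℝ (g' - g) e + inner ℝ g e := by rw [inner_sub_left]; ring
  have hY := neg_mul_inner_le (k := 2 * ν / (1 - ν) * β) (by positivity) (2 * β) e (g' - g)
  have hbb' : 2 * ν / (1 - ν) * β ≤ bb - β := by
    have : β * (1 + ν) / (1 - ν) = β + 2 * ν / (1 - ν) * β := by field_simp; ring
    linarith
  have hY2 : (2 * β) ^ 2 / (4 * (2 * ν / (1 - ν) * β)) = β * (1 - ν) / (2 * ν) := by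
    field_simp
    ring
  rw [hY2, real_inner_comm] at hY
  have hY3 : -(2 * β) * inner ℝ (g' - g) e ≤
      (bb - β) * ‖g' - g‖ ^ 2 + β * (1 - ν) / (2 * ν) * ‖e‖ ^ 2 :=
    hY.trans (by gcongr)
  have hh : 0 ≤ t * (t - 1) := by positivity
  have hco' := mul_le_mul_of_nonneg_left hco hh
  have hY4 := mul_le_mul_of_nonneg_left hY3 hh
  rw [inner_sub_left, mul_sub (t * (t - 1)), i1, i2, hP, hE] at hco'
  have hS : inner ℝ g (x - xs) = inner ℝ g (x - z) + inner ℝ g (z - xs) := by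
    rw [← inner_add_right]; congr 1; abel
  rw [hS] at hg
  unfold lyap
  rw [hDn, hZn, hN]
  have c3 : ν * ((3 - 2 * ν) * t - 1) / (t - ν) =
      ν * (1 - ν) * (2 * t) / (t - ν) + ν * (t - 1) / (t - ν) := by
    rw [← add_div]; congr 1; ring
  have ca : t * (t - 1) * (t - 2 + ν) / (t - ν) = t * (t - 1) - 2 * (1 - ν) *
      (t * (t - 1) / (t - ν)) := by
    field_simp; ring
  have cη : (t - 1) * (t * η) = 2 * β * (t * (t - 1)) -
      2 * β * (1 - ν) * (t * (t - 1) / (t - ν)) := by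
    rw [hη]; field_simp; ring
  rw [c3, ca]
  rw [cη] at hco'
  generalize t * (t - 1) / (t - ν) = a at *
  generalize ν * (1 - ν) * (2 * t) / (t - ν) = b1 at *
  generalize ν * (t - 1) / (t - ν) = b2 at *
  have cY : β * (t * (t - 1)) * (1 - ν) / (2 * ν) = t * (t - 1) * (β * (1 - ν) / (2 * ν)) := by
    ring
  rw [cY]
  generalize β * (1 - ν) / (2 * ν) = b3 at *
  linarith

/-- The quadratic coefficient of `g` left over after one step. -/
theorem lyap_coeff_residual {ν t : ℝ} (hν : 0 < ν) (hν' : ν < 1 / 3) (ht : 1 + 6 * ν < t) :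
    t * (t - 1) * (t - 2 + ν) / (t - ν) - (1 + ν) / (1 - ν) +
      ν * ((3 - 2 * ν) * t - 1) / (t - ν) + 4 / 5 ≤ (t - 2 * ν) * (t - 2 * ν - 1) := by
  have h1ν : 0 < 1 - ν := by linarith
  have htν : 0 < t - ν := by linarith
  have h1 : 1 + 2 * ν + 2 * ν ^ 2 ≤ (1 + ν) / (1 - ν) := by
    rw [le_div_iff₀ h1ν]; nlinarith [pow_pos hν 3]
  have h2 : (t - 2 * ν) * (t - 2 * ν - 1) - t * (t - 1) * (t - 2 + ν) / (t - ν) -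
      ν * ((3 - 2 * ν) * t - 1) / (t - ν) = 2 * (1 - 3 * ν) * (t - 1) + 4 * ν ^ 2 - 3 * ν -
        ν * (1 - ν) / (t - ν) := by
    field_simp
    ring
  have h3 : ν * (1 - ν) / (t - ν) ≤ ν * (1 - ν) := by
    apply div_le_self (by positivity); linarith
  nlinarith [mul_nonneg (by linarith : 0 ≤ 1 - 3 * ν) (by linarith : 0 ≤ t - 1 - 6 * ν)]

/-- The total coefficient of the squared perturbation, after all uses of Young's inequality. -/
theorem lyap_coeff_error {ν t : ℝ} (hν : 0 < ν) (hν' : ν < 1 / 3) (ht : 1 + 6 * ν < t) :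
    (ν * ((3 - 2 * ν) * t - 1) / (t - ν) - (1 - ν) * (t * (t - 1) / (t - ν))) ^ 2 * (5 / 4) +
      ν * ((3 - 2 * ν) * t - 1) / (t - ν) + t * (t - 1) * (1 - ν) / (2 * ν) +
      2 * ν * (1 - ν) * (t * (t - 1) / (t - ν)) +
      (t - 1) * (t - 1 - 2 * ν) / (2 * (1 - ν)) ≤ 5 / (4 * ν) * (t * (t - 1)) := by
  have h1ν : 0 < 1 - ν := by linarith
  have htν : 0 < t - ν := by linarith
  have ht1 : 0 < t - 1 := by linarith
  have ht0 : 0 < t := by linarith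
  have hh : 6 * ν * (1 + 6 * ν) ≤ t * (t - 1) := by nlinarith
  have ha0 : 0 ≤ t * (t - 1) / (t - ν) := by positivity
  have ha : t * (t - 1) / (t - ν) ≤ t * (t - 1) := div_le_self (by positivity) (by linarith)
  have ha2 : (t * (t - 1) / (t - ν)) ^ 2 ≤ t * (t - 1) := by
    rw [div_pow, div_le_iff₀ (by positivity), sq (t * (t - 1))]
    gcongr
    nlinarith
  have hc0 : 0 ≤ ν * ((3 - 2 * ν) * t - 1) / (t - ν) := by
    refine div_nonneg (mul_nonneg hν.le ?_) htν.le
    nlinarith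
  have hc : ν * ((3 - 2 * ν) * t - 1) / (t - ν) ≤ 3 * ν := by
    rw [div_le_iff₀ htν]
    have : (3 - 2 * ν) * t - 1 ≤ 3 * (t - ν) := by nlinarith [mul_pos hν ht0]
    nlinarith
  have hz : (t - 1) * (t - 1 - 2 * ν) / (2 * (1 - ν)) ≤ 3 / 4 * (t * (t - 1)) := by
    rw [div_le_iff₀ (by linarith)]
    nlinarith [mul_pos ht0 ht1]
  set a := t * (t - 1) / (t - ν)
  set c := ν * ((3 - 2 * ν) * t - 1) / (t - ν)
  set h := t * (t - 1)
  have hh0 : 0 < h := by positivity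
  have hsq : (c - (1 - ν) * a) ^ 2 ≤ (1 - ν) ^ 2 * h + h / 4 := by
    have : 0 ≤ c * ((1 - ν) * a) := by positivity
    nlinarith [mul_le_mul_of_nonneg_left ha2 (sq_nonneg (1 - ν)), mul_le_mul hc hc hc0 (by linarith)]
  have e1 : h * (1 - ν) / (2 * ν) = h * ((1 - ν) / (2 * ν)) := by ring
  have e2 : 2 * ν * (1 - ν) * a ≤ 2 * ν * (1 - ν) * h := by gcongr
  have e3 : (5 / 4) * ((1 - ν) ^ 2 + 1 / 4) + 1 / 2 + (1 - ν) / (2 * ν) + 2 * ν * (1 - ν) + 3 / 4 ≤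
      5 / (4 * ν) := by
    rw [← sub_nonneg]
    have : 5 / (4 * ν) - ((5 / 4) * ((1 - ν) ^ 2 + 1 / 4) + 1 / 2 + (1 - ν) / (2 * ν) +
        2 * ν * (1 - ν) + 3 / 4) = (12 - 37 * ν + 8 * ν ^ 2 + 12 * ν ^ 3) / (16 * ν) := by
      field_simp
      ring
    rw [this]
    apply div_nonneg _ (by positivity)
    nlinarith [pow_pos hν 3, sq_nonneg (ν - 1 / 3)]
  have e4 := mul_le_mul_of_nonneg_right e3 hh0.le
  rw [e1]
  nlinarith

set_option maxHeartbeats 1000000 in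
/-- One step of the method decreases the Lyapunov function, up to the squared perturbation `e` of
the residual. -/
theorem lyap_step {ν β bb t LU : ℝ} (hν : 0 < ν) (hν' : ν < 1 / 3) (hβ : 0 < β)
    (ht : 1 + 6 * ν < t) (hbb : β * (1 + ν) / (1 - ν) ≤ bb)
    {xs g g' e x z x' z' : E}
    (hx' : x' = ((t - 1) / t) • x + (1 / t) • z - (2 * β * (t - 1) / (t - ν)) • (g + e))
    (hz' : z' = z - (ν * (2 * β * (t - 1) / (t - ν))) • (g + e))
    (hco : bb * ‖g' - g‖ ^ 2 + LU ≤ inner ℝ (g' - g) (x' - x))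
    (hg : bb * ‖g‖ ^ 2 ≤ inner ℝ g (x - xs)) :
    lyap ν β t xs g' x' z' + t * (t - 1) * LU ≤
      lyap ν β (t - 2 * ν) xs g x z + 5 * β / (4 * ν) * (t * (t - 1)) * ‖e‖ ^ 2 := by
  have h1ν : 0 < 1 - ν := by linarith
  have htν : 0 < t - ν := by linarith
  have ht1 : 0 < t - 1 := by linarith
  have ht0 : 0 < t := by linarith
  have hτ1 : 0 < t - 1 - 2 * ν := by linarith
  refine (lyap_step_raw hν hν' hβ (by linarith) hbb hx' hz' hco hg).trans ?_
  have A := mul_le_mul_of_nonneg_left (lyap_coeff_residual hν hν' ht) hβ.le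
  have B := mul_le_mul_of_nonneg_left (lyap_coeff_error hν hν' ht) hβ.le
  have A' := mul_le_mul_of_nonneg_right A (sq_nonneg ‖g‖)
  have B' := mul_le_mul_of_nonneg_right B (sq_nonneg ‖e‖)
  have hbb' := mul_le_mul_of_nonneg_right hbb (sq_nonneg ‖g‖)
  -- The surplus in the weight of `‖z - xs‖²` absorbs `⟨e, z - xs⟩`.
  have hCs : (t - 2 * ν - ν) / (4 * ν * β * (t - 2 * ν - 1)) =
      (t - ν) / (4 * ν * β * (t - 1)) + (1 - ν) / (2 * β * ((t - 1) * (t - 1 - 2 * ν))) := by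
    have : t - 2 * ν - 1 = t - 1 - 2 * ν := by ring
    rw [this]
    field_simp
    ring
  have hYz := neg_mul_inner_le (k := (1 - ν) / (2 * β * ((t - 1) * (t - 1 - 2 * ν))))
    (by positivity) 1 e (z - xs)
  have hYz2 : (1 : ℝ) ^ 2 / (4 * ((1 - ν) / (2 * β * ((t - 1) * (t - 1 - 2 * ν))))) =
      β * ((t - 1) * (t - 1 - 2 * ν) / (2 * (1 - ν))) := by
    field_simp
    ring
  rw [hYz2] at hYz
  -- The surplus in the weight of `‖x - z‖²` absorbs `⟨e, x - z⟩`.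
  have hQs : ν * (t - ν) / (2 * β * (1 - ν) * t) + ν * (t - ν) / (2 * β * (1 - ν) * (t * (t - 1)))
      ≤ ν * (t - 2 * ν) * (t - 2 * ν - ν) / (2 * β * (1 - ν) * (t - 2 * ν - 1) ^ 2) := by
    have e1 : ν * (t - ν) / (2 * β * (1 - ν) * t) +
        ν * (t - ν) / (2 * β * (1 - ν) * (t * (t - 1))) =
        ν / (2 * β * (1 - ν)) * ((t - ν) / (t - 1)) := by
      field_simp
      ring
    have e2 : ν * (t - 2 * ν) * (t - 2 * ν - ν) / (2 * β * (1 - ν) * (t - 2 * ν - 1) ^ 2) =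
        ν / (2 * β * (1 - ν)) * ((t - 2 * ν) * (t - 2 * ν - ν) / (t - 2 * ν - 1) ^ 2) := by
      have : t - 2 * ν - 1 ≠ 0 := by linarith
      field_simp
    rw [e1, e2]
    gcongr ?_ * ?_
    rw [div_le_div_iff₀ ht1 (by have : 0 < t - 2 * ν - 1 := by linarith
                                positivity)]
    have hs : t - 2 * ν - 1 = t - 1 - 2 * ν := by ring
    rw [hs]
    have e3 : (t - ν) * (t - 1 - 2 * ν) ≤ (t - 2 * ν - ν) * (t - 1) := by nlinarith
    calc (t - ν) * (t - 1 - 2 * ν) ^ 2 = (t - ν) * (t - 1 - 2 * ν) * (t - 1 - 2 * ν) := by ring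
      _ ≤ (t - 2 * ν - ν) * (t - 1) * (t - 2 * ν) := by
          refine mul_le_mul e3 (by linarith) hτ1.le (mul_nonneg ?_ ht1.le)
          linarith
      _ = _ := by ring
  have hYd := neg_mul_inner_le (k := ν * (t - ν) / (2 * β * (1 - ν) * (t * (t - 1))))
    (by positivity) (2 * ν) e (x - z)
  have hYd2 : (2 * ν) ^ 2 / (4 * (ν * (t - ν) / (2 * β * (1 - ν) * (t * (t - 1))))) =
      β * (2 * ν * (1 - ν) * (t * (t - 1) / (t - ν))) := by
    field_simp
    ring
  rw [hYd2] at hYd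
  have hQs' := mul_le_mul_of_nonneg_right hQs (sq_nonneg ‖x - z‖)
  -- The surplus in the weight of `‖g‖²` absorbs `⟨g, e⟩`.
  have hYg := neg_mul_inner_le (k := β * (4 / 5)) (by positivity)
    (-(2 * β * (ν * ((3 - 2 * ν) * t - 1) / (t - ν) - (1 - ν) * (t * (t - 1) / (t - ν))))) e g
  rw [neg_neg, real_inner_comm] at hYg
  have hYg2 : (-(2 * β * (ν * ((3 - 2 * ν) * t - 1) / (t - ν) -
      (1 - ν) * (t * (t - 1) / (t - ν))))) ^ 2 / (4 * (β * (4 / 5))) =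
      β * ((ν * ((3 - 2 * ν) * t - 1) / (t - ν) - (1 - ν) * (t * (t - 1) / (t - ν))) ^ 2 *
        (5 / 4)) := by
    generalize ν * ((3 - 2 * ν) * t - 1) / (t - ν) - (1 - ν) * (t * (t - 1) / (t - ν)) = w
    field_simp
    ring
  rw [hYg2] at hYg
  have eB : 5 * β / (4 * ν) * (t * (t - 1)) = β * (5 / (4 * ν) * (t * (t - 1))) := by ring
  have eb : β * (1 + ν) / (1 - ν) = β * ((1 + ν) / (1 - ν)) := by ring
  have eC : β * (t * (t - 1)) * (1 - ν) / (2 * ν) = β * (t * (t - 1) * (1 - ν) / (2 * ν)) := by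
    ring
  unfold lyap
  rw [eB, hCs, eC]
  rw [eb] at hbb'
  generalize ν * ((3 - 2 * ν) * t - 1) / (t - ν) = c at *
  generalize t * (t - 1) / (t - ν) = a at *
  generalize (t - 1) * (t - 1 - 2 * ν) / (2 * (1 - ν)) = k1 at *
  generalize (1 - ν) / (2 * β * ((t - 1) * (t - 1 - 2 * ν))) = k2 at *
  generalize t * (t - 1) * (1 - ν) / (2 * ν) = k3 at *
  generalize ν * (t - ν) / (2 * β * (1 - ν) * (t * (t - 1))) = k4 at *
  generalize (1 + ν) / (1 - ν) = k5 at *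
  generalize t * (t - 1) * (t - 2 + ν) / (t - ν) = k6 at *
  linarith

end Lyapunov

/-! ### Sample averages and independence -/

section Independence

variable {Ω : Type*} [MeasurableSpace Ω] {P : Measure Ω} [IsProbabilityMeasure P]

theorem integral_inner_eq_zero_of_indepFun {p : ℕ} {X Y : Ω → Vec p} (h : IndepFun X Y P)
    (hX : MemLp X 2 P) (hY : MemLp Y 2 P) (hY0 : ∫ ω, Y ω ∂P = 0) :
    ∫ ω, inner ℝ (X ω) (Y ω) ∂P = 0 := by
  have h1 := h.integral_bilin (hX.integrable (by norm_num)) (hY.integrable (by norm_num))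
    (innerSL ℝ : Vec p →L[ℝ] Vec p →L[ℝ] ℝ)
  rw [hY0, map_zero] at h1
  exact h1

/-- The second moment of a constant plus a sum of pairwise independent centred vectors. -/
theorem integral_norm_const_add_sum_sq {p : ℕ} {ι : Type*} [Fintype ι] {Y : ι → Ω → Vec p}
    (hY : ∀ i, MemLp (Y i) 2 P) (h0 : ∀ i, ∫ ω, Y i ω ∂P = 0)
    (hind : ∀ i j, i ≠ j → IndepFun (Y i) (Y j) P) (c : Vec p) :
    ∫ ω, ‖c + ∑ i, Y i ω‖ ^ 2 ∂P = ‖c‖ ^ 2 + ∑ i, ∫ ω, ‖Y i ω‖ ^ 2 ∂P := by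
  classical
  have hsum : MemLp (fun ω => ∑ i, Y i ω) 2 P := memLp_finsetSum _ fun i _ => hY i
  have hI := fun i => (hY i).integrable (by norm_num : (1 : ENNReal) ≤ 2)
  have h1 : Integrable (fun ω => 2 * inner ℝ c (∑ i, Y i ω)) P :=
    ((hsum.integrable (by norm_num)).const_inner c).const_mul 2
  have h2 : ∫ ω, inner ℝ c (∑ i, Y i ω) ∂P = 0 := by
    rw [integral_inner (hsum.integrable (by norm_num)), integral_finsetSum _ fun i _ => hI i]
    simp [h0]
  have h3 : ∫ ω, ‖∑ i, Y i ω‖ ^ 2 ∂P = ∑ i, ∫ ω, ‖Y i ω‖ ^ 2 ∂P := by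
    have e : ∀ ω, ‖∑ i, Y i ω‖ ^ 2 = ∑ i, ∑ j, inner ℝ (Y i ω) (Y j ω) := fun ω => by
      rw [← real_inner_self_eq_norm_sq, sum_inner]
      simp_rw [inner_sum]
    simp_rw [e]
    rw [integral_finsetSum _ fun i _ => integrable_finsetSum _ fun j _ =>
      integrable_inner_of_memLp (hY i) (hY j)]
    refine Finset.sum_congr rfl fun i _ => ?_
    rw [integral_finsetSum _ fun j _ => integrable_inner_of_memLp (hY i) (hY j),
      Finset.sum_eq_single i]
    · simp_rw [real_inner_self_eq_norm_sq]
    · intro j _ hji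
      exact integral_inner_eq_zero_of_indepFun (hind i j hji.symm) (hY i) (hY j) (h0 j)
    · simp
  calc ∫ ω, ‖c + ∑ i, Y i ω‖ ^ 2 ∂P
      = ∫ ω, ((‖c‖ ^ 2 + 2 * inner ℝ c (∑ i, Y i ω)) + ‖∑ i, Y i ω‖ ^ 2) ∂P := by
        simp_rw [norm_add_sq_real]
    _ = ∫ ω, (‖c‖ ^ 2 + 2 * inner ℝ c (∑ i, Y i ω)) ∂P + ∫ ω, ‖∑ i, Y i ω‖ ^ 2 ∂P :=
        integral_add ((integrable_const _).add h1) (integrable_norm_sq hsum)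
    _ = _ := by
        rw [integral_add (integrable_const _) h1, integral_const_mul, h2, h3]
        simp

/-- The second moment of a constant plus a centred sample average. -/
theorem integral_norm_const_add_average_sq {p m : ℕ} (hm : 0 < m) {Ξ : Type*} [MeasurableSpace Ξ]
    {D : Measure Ξ} [IsProbabilityMeasure D] {S : Fin m → Ω → Ξ} (hS : ∀ i, Measurable (S i))
    (hlaw : ∀ i, P.map (S i) = D) (hind : iIndepFun S P) {f : Ξ → Vec p} (hfm : Measurable f)
    (hf : MemLp f 2 D) (c : Vec p) :
    Integrable (fun ω => ‖c + ((m : ℝ)⁻¹ • ∑ i, f (S i ω) - ∫ ξ, f ξ ∂D)‖ ^ 2) P ∧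
    ∫ ω, ‖c + ((m : ℝ)⁻¹ • ∑ i, f (S i ω) - ∫ ξ, f ξ ∂D)‖ ^ 2 ∂P =
      ‖c‖ ^ 2 + (m : ℝ)⁻¹ * ∫ ξ, ‖f ξ - ∫ ξ, f ξ ∂D‖ ^ 2 ∂D := by
  set a := ∫ ξ, f ξ ∂D with ha
  have hm' : (m : ℝ) ≠ 0 := by positivity
  let u : Ξ → Vec p := fun ξ => (m : ℝ)⁻¹ • (f ξ - a)
  have hum : Measurable u := by fun_prop
  have hu : MemLp u 2 D := (hf.sub (memLp_const a)).const_smul (m : ℝ)⁻¹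
  have hu0 : ∫ ξ, u ξ ∂D = 0 := by
    simp only [u]
    rw [integral_smul, integral_sub (hf.integrable (by norm_num)) (integrable_const _)]
    simp [ha]
  have huS : ∀ i, MemLp (fun ω => u (S i ω)) 2 P := fun i =>
    MemLp.comp_of_map (g := u) (by rw [hlaw i]; exact hu) (hS i).aemeasurable
  have hS0 : ∀ i, ∫ ω, u (S i ω) ∂P = 0 := fun i => by
    rw [← hu0, ← hlaw i, integral_map (hS i).aemeasurable hum.aestronglyMeasurable]
  have hSq : ∀ i, ∫ ω, ‖u (S i ω)‖ ^ 2 ∂P = ∫ ξ, ‖u ξ‖ ^ 2 ∂D := fun i => by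
    rw [← hlaw i, integral_map (hS i).aemeasurable
      (hum.norm.pow_const 2).aestronglyMeasurable]
  have hsum : ∀ ω, (m : ℝ)⁻¹ • ∑ i, f (S i ω) - a = ∑ i, u (S i ω) := fun ω => by
    simp only [u]
    rw [← Finset.smul_sum, Finset.sum_sub_distrib, smul_sub]
    congr 1
    simp only [Finset.sum_const, Finset.card_univ, Fintype.card_fin]
    rw [← Nat.cast_smul_eq_nsmul ℝ, smul_smul, inv_mul_cancel₀ hm', one_smul]
  simp_rw [hsum]
  refine ⟨integrable_norm_sq ((memLp_const c).add (memLp_finsetSum _ fun i _ => huS i)), ?_⟩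
  rw [integral_norm_const_add_sum_sq huS hS0 (fun i j hij => (hind.indepFun hij).comp hum hum)]
  simp_rw [hSq]
  simp only [u, norm_smul, mul_pow, Finset.sum_const, Finset.card_univ, Fintype.card_fin,
    nsmul_eq_mul, integral_const_mul, Real.norm_eq_abs, sq_abs]
  congr 1
  field_simp

/-- Conditioning on `X`: a bound on the partial expectation over an independent `Z` integrates. -/
theorem IndepFun.integral_le_of_forall {α γ : Type*} [MeasurableSpace α] [MeasurableSpace γ]
    {X : Ω → α} {Z : Ω → γ} (h : IndepFun X Z P) (hX : Measurable X) (hZ : Measurable Z)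
    {φ : α → γ → ℝ} (hφ : Measurable (Function.uncurry φ)) (hφ0 : ∀ x z, 0 ≤ φ x z)
    {ψ : α → ℝ} (hψ : Measurable ψ) (hψX : Integrable (fun ω => ψ (X ω)) P)
    (hle : ∀ x, Integrable (fun ω => φ x (Z ω)) P ∧ ∫ ω, φ x (Z ω) ∂P ≤ ψ x) :
    Integrable (fun ω => φ (X ω) (Z ω)) P ∧
      ∫ ω, φ (X ω) (Z ω) ∂P ≤ ∫ ω, ψ (X ω) ∂P := by
  have hprod := (indepFun_iff_map_prod_eq_prod_map_map hX.aemeasurable hZ.aemeasurable).1 h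
  have : IsProbabilityMeasure (P.map X) := Measure.isProbabilityMeasure_map hX.aemeasurable
  have : IsProbabilityMeasure (P.map Z) := Measure.isProbabilityMeasure_map hZ.aemeasurable
  have hsec : ∀ x, Measurable (φ x) := fun x => hφ.comp measurable_prodMk_left
  have hle' : ∀ x, Integrable (φ x) (P.map Z) ∧ ∫ z, φ x z ∂(P.map Z) ≤ ψ x := fun x => by
    rw [integrable_map_measure (hsec x).aestronglyMeasurable hZ.aemeasurable,
      integral_map hZ.aemeasurable (hsec x).aestronglyMeasurable]
    exact hle x
  have hψ' : Integrable ψ (P.map X) := by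
    rw [integrable_map_measure hψ.aestronglyMeasurable hX.aemeasurable]
    exact hψX
  have hint : Integrable (Function.uncurry φ) ((P.map X).prod (P.map Z)) := by
    rw [integrable_prod_iff hφ.aestronglyMeasurable]
    refine ⟨.of_forall fun x => (hle' x).1, hψ'.mono' ?_ (.of_forall fun x => ?_)⟩
    · exact (hφ.norm.stronglyMeasurable.integral_prod_right (f := fun x z => ‖φ x z‖)
        ).aestronglyMeasurable
    · rw [Real.norm_of_nonneg (integral_nonneg fun z => norm_nonneg _)]
      simp only [Function.uncurry, Real.norm_of_nonneg (hφ0 _ _)]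
      exact (hle' x).2
  have hint' := hint
  rw [← hprod, integrable_map_measure hφ.aestronglyMeasurable (hX.prodMk hZ).aemeasurable] at hint'
  refine ⟨hint', ?_⟩
  have e1 : ∫ ω, φ (X ω) (Z ω) ∂P = ∫ q, Function.uncurry φ q ∂((P.map X).prod (P.map Z)) := by
    rw [← hprod, integral_map (hX.prodMk hZ).aemeasurable hφ.aestronglyMeasurable]
    rfl
  rw [e1, integral_prod _ hint, ← integral_map hX.aemeasurable hψ.aestronglyMeasurable]
  exact integral_mono hint.integral_prod_left hψ' fun x => (hle' x).2

end Independence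

section Sampling

variable {p : ℕ} {Ω Ξ : Type*} [MeasurableSpace Ω] [MeasurableSpace Ξ] {P : Measure Ω}
  [IsProbabilityMeasure P] {D : Measure Ξ} {b n : ℕ}

/-- The randomness of iteration `k`. -/
def noise (sw : ℕ → Ω → Bool) (S : ℕ → Fin b → Ω → Ξ) (Sbar : ℕ → Fin n → Ω → Ξ) (k : ℕ)
    (ω : Ω) : Bool × (Fin b → Ξ) × (Fin n → Ξ) :=
  (sw k ω, (fun i => S k i ω), (fun j => Sbar k j ω))

/-- The state `(xᵏ, zᵏ, F̃ᵏ)` along the sample path `ω`, as a triple. -/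
noncomputable def path (Fo : Vec p → Ξ → Vec p) (T : Vec p → Set (Vec p)) (lam μ r β : ℝ)
    (x0 : Vec p) (sw : ℕ → Ω → Bool) (S : ℕ → Fin b → Ω → Ξ) (Sbar : ℕ → Fin n → Ω → Ξ)
    (k : ℕ) (ω : Ω) : Vec p × Vec p × Vec p :=
  let s := run Fo T lam μ r β x0 (fun k => sw k ω) (fun k i => S k i ω) (fun k j => Sbar k j ω) k
  (s.x, s.z, s.Fest)

/-- The iterate `xᵏ⁺¹` as a function of the state at iteration `k`. -/
noncomputable def nextX (T : Vec p → Set (Vec p)) (lam μ r β : ℝ) (k : ℕ)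
    (s : Vec p × Vec p × Vec p) : Vec p :=
  ((tSeq μ r k - 1) / tSeq μ r k) • s.1 + (1 / tSeq μ r k) • s.2.1 -
    etaSeq μ r β k • residual T lam s.1 s.2.2

/-- The iterate `zᵏ⁺¹` as a function of the state at iteration `k`. -/
noncomputable def nextZ (T : Vec p → Set (Vec p)) (lam μ r β : ℝ) (k : ℕ)
    (s : Vec p × Vec p × Vec p) : Vec p :=
  s.2.1 - (μ / 2 * etaSeq μ r β k) • residual T lam s.1 s.2.2

/-- The estimator `F̃ᵏ⁺¹` as a function of the state at iteration `k` and the noise at iteration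
`k + 1`. -/
noncomputable def nextF (Fo : Vec p → Ξ → Vec p) (T : Vec p → Set (Vec p)) (lam μ r β : ℝ) (k : ℕ)
    (s : Vec p × Vec p × Vec p) (q : Bool × (Fin b → Ξ) × (Fin n → Ξ)) : Vec p :=
  if q.1 = true then batchMean Fo q.2.2 (nextX T lam μ r β k s)
  else s.2.2 + batchMean Fo q.2.1 (nextX T lam μ r β k s) - batchMean Fo q.2.1 s.1

variable {Fo : Vec p → Ξ → Vec p} {F : Vec p → Vec p} {T : Vec p → Set (Vec p)}
  {σ L Lhat ρ lam μ r β : ℝ} {x0 : Vec p} {pr : ℕ → ℝ}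
  {sw : ℕ → Ω → Bool} {S : ℕ → Fin b → Ω → Ξ} {Sbar : ℕ → Fin n → Ω → Ξ}

omit [MeasurableSpace Ω] [MeasurableSpace Ξ] in
theorem path_succ (k : ℕ) (ω : Ω) :
    path Fo T lam μ r β x0 sw S Sbar (k + 1) ω =
      (nextX T lam μ r β k (path Fo T lam μ r β x0 sw S Sbar k ω),
       nextZ T lam μ r β k (path Fo T lam μ r β x0 sw S Sbar k ω),
       nextF Fo T lam μ r β k (path Fo T lam μ r β x0 sw S Sbar k ω)
        (noise sw S Sbar (k + 1) ω)) := by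
  refine Prod.ext rfl (Prod.ext ?_ rfl)
  simp only [path, run, nextZ]
  module

theorem measurable_batchMean (h : Measurable (Function.uncurry Fo)) {m : ℕ} :
    Measurable fun q : (Fin m → Ξ) × Vec p => batchMean Fo q.1 q.2 := by
  have h1 : ∀ i : Fin m, Measurable fun q : (Fin m → Ξ) × Vec p => Fo q.2 (q.1 i) := fun i =>
    h.comp (measurable_snd.prodMk ((measurable_pi_apply i).comp measurable_fst))
  unfold batchMean
  fun_prop

theorem IsProblem.measurable_nextX (hP : IsProblem D Fo F T σ L ρ)
    (hA : AdmissibleParams L Lhat ρ lam μ r β) (k : ℕ) :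
    Measurable (nextX T lam μ r β k) := by
  have h : Measurable fun s : Vec p × Vec p × Vec p => residual T lam s.1 s.2.2 :=
    (hP.continuous_residual hA).measurable.comp (measurable_fst.prodMk measurable_snd.snd)
  unfold nextX
  fun_prop

theorem IsProblem.measurable_nextZ (hP : IsProblem D Fo F T σ L ρ)
    (hA : AdmissibleParams L Lhat ρ lam μ r β) (k : ℕ) :
    Measurable (nextZ T lam μ r β k) := by
  have h : Measurable fun s : Vec p × Vec p × Vec p => residual T lam s.1 s.2.2 :=
    (hP.continuous_residual hA).measurable.comp (measurable_fst.prodMk measurable_snd.snd)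
  unfold nextZ
  fun_prop

theorem IsProblem.measurable_nextF (hP : IsProblem D Fo F T σ L ρ)
    (hA : AdmissibleParams L Lhat ρ lam μ r β) (k : ℕ) :
    Measurable (Function.uncurry (nextF (b := b) (n := n) Fo T lam μ r β k)) := by
  have hx := hP.measurable_nextX hA k
  have h1 : Measurable fun q : (Vec p × Vec p × Vec p) × (Bool × (Fin b → Ξ) × (Fin n → Ξ)) =>
      batchMean Fo q.2.2.2 (nextX T lam μ r β k q.1) :=
    (measurable_batchMean hP.measurable_oracle).comp
      (f := fun q : (Vec p × Vec p × Vec p) × (Bool × (Fin b → Ξ) × (Fin n → Ξ)) =>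
        (q.2.2.2, nextX T lam μ r β k q.1)) (by fun_prop)
  have h2 : Measurable fun q : (Vec p × Vec p × Vec p) × (Bool × (Fin b → Ξ) × (Fin n → Ξ)) =>
      batchMean Fo q.2.2.1 (nextX T lam μ r β k q.1) :=
    (measurable_batchMean hP.measurable_oracle).comp
      (f := fun q : (Vec p × Vec p × Vec p) × (Bool × (Fin b → Ξ) × (Fin n → Ξ)) =>
        (q.2.2.1, nextX T lam μ r β k q.1)) (by fun_prop)
  have h3 : Measurable fun q : (Vec p × Vec p × Vec p) × (Bool × (Fin b → Ξ) × (Fin n → Ξ)) =>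
      batchMean Fo q.2.2.1 q.1.1 :=
    (measurable_batchMean hP.measurable_oracle).comp
      (f := fun q : (Vec p × Vec p × Vec p) × (Bool × (Fin b → Ξ) × (Fin n → Ξ)) =>
        (q.2.2.1, q.1.1)) (by fun_prop)
  have h4 : MeasurableSet {q : (Vec p × Vec p × Vec p) × (Bool × (Fin b → Ξ) × (Fin n → Ξ)) |
      q.2.1 = true} :=
    (measurable_fst.comp measurable_snd) (measurableSet_singleton true)
  have h5 : Measurable fun q : (Vec p × Vec p × Vec p) × (Bool × (Fin b → Ξ) × (Fin n → Ξ)) =>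
      q.1.2.2 + batchMean Fo q.2.2.1 (nextX T lam μ r β k q.1) - batchMean Fo q.2.2.1 q.1.1 := by
    fun_prop
  exact Measurable.ite h4 h1 h5

omit [IsProbabilityMeasure P] in
theorem IsSampling.measurable_noise (hS : IsSampling P D pr sw S Sbar) (k : ℕ) :
    Measurable (noise sw S Sbar k) :=
  (hS.measurable_sw k).prodMk ((measurable_pi_iff.2 (hS.measurable_S k)).prodMk
    (measurable_pi_iff.2 (hS.measurable_Sbar k)))

omit [MeasurableSpace Ω] in
/-- The state at iteration `k` depends on the noise of the iterations up to `k` only. -/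
theorem IsProblem.measurable_path_past (hP : IsProblem D Fo F T σ L ρ)
    (hA : AdmissibleParams L Lhat ρ lam μ r β) (k : ℕ) :
    Measurable[⨆ i ∈ Set.Iic k, MeasurableSpace.comap (noise sw S Sbar i) inferInstance]
      (path Fo T lam μ r β x0 sw S Sbar k) := by
  have hn : ∀ k, Measurable[⨆ i ∈ Set.Iic k,
      MeasurableSpace.comap (noise sw S Sbar i) inferInstance] (noise sw S Sbar k) := fun k =>
    measurable_iff_comap_le.2 (le_iSup₂_of_le k (Set.mem_Iic.2 le_rfl) le_rfl)
  induction k with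
  | zero =>
    have h0 : Measurable fun q : Bool × (Fin b → Ξ) × (Fin n → Ξ) => batchMean Fo q.2.2 x0 :=
      (measurable_batchMean hP.measurable_oracle).comp
        (f := fun q : Bool × (Fin b → Ξ) × (Fin n → Ξ) => (q.2.2, x0)) (by fun_prop)
    have h1 : Measurable fun q : Bool × (Fin b → Ξ) × (Fin n → Ξ) =>
        ((x0, x0, batchMean Fo q.2.2 x0) : Vec p × Vec p × Vec p) := by fun_prop
    exact h1.comp (hn 0)
  | succ k ih =>
    have hmono : (⨆ i ∈ Set.Iic k, MeasurableSpace.comap (noise sw S Sbar i) inferInstance) ≤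
        ⨆ i ∈ Set.Iic (k + 1), MeasurableSpace.comap (noise sw S Sbar i) inferInstance :=
      biSup_mono fun i hi => Set.mem_Iic.2 ((Set.mem_Iic.1 hi).trans (Nat.le_succ k))
    have ih' := ih.mono hmono le_rfl
    have h1 : Measurable fun q : (Vec p × Vec p × Vec p) × (Bool × (Fin b → Ξ) × (Fin n → Ξ)) =>
        ((nextX T lam μ r β k q.1, nextZ T lam μ r β k q.1, nextF Fo T lam μ r β k q.1 q.2) :
          Vec p × Vec p × Vec p) :=
      ((hP.measurable_nextX hA k).comp measurable_fst).prodMk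
        (((hP.measurable_nextZ hA k).comp measurable_fst).prodMk (hP.measurable_nextF hA k))
    have h2 := ih'.prodMk (hn (k + 1))
    have h3 := h1.comp h2
    rw [funext (path_succ (Fo := Fo) (T := T) (lam := lam) (μ := μ) (r := r) (β := β) (x0 := x0)
      (sw := sw) (S := S) (Sbar := Sbar) k)]
    exact h3

omit [IsProbabilityMeasure P] in
theorem IsProblem.measurable_path (hP : IsProblem D Fo F T σ L ρ)
    (hA : AdmissibleParams L Lhat ρ lam μ r β) (hS : IsSampling P D pr sw S Sbar) (k : ℕ) :
    Measurable (path Fo T lam μ r β x0 sw S Sbar k) :=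
  (hP.measurable_path_past hA k).mono
    (iSup₂_le fun i _ => measurable_iff_comap_le.1 (hS.measurable_noise i)) le_rfl

omit [IsProbabilityMeasure P] in
theorem IsProblem.indepFun_path_noise (hP : IsProblem D Fo F T σ L ρ)
    (hA : AdmissibleParams L Lhat ρ lam μ r β) (hS : IsSampling P D pr sw S Sbar) (k : ℕ) :
    IndepFun (path Fo T lam μ r β x0 sw S Sbar k) (noise sw S Sbar (k + 1)) P := by
  rw [IndepFun_iff_Indep]
  have h := indep_iSup_of_disjoint
    (fun i => measurable_iff_comap_le.1 (hS.measurable_noise i))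
    ((iIndepFun_iff_iIndep _ _ _).1 hS.indep_steps)
    (S := Set.Iic k) (T := {k + 1}) (by simp)
  refine indep_of_indep_of_le_left (indep_of_indep_of_le_right h ?_)
    (measurable_iff_comap_le.1 (hP.measurable_path_past hA k))
  exact le_iSup₂_of_le (k + 1) rfl le_rfl

theorem IsSampling.integral_sw (hS : IsSampling P D pr sw S Sbar) {k : ℕ}
    (hk : 1 ≤ k) (h0 : 0 ≤ pr k) (u v : ℝ) :
    ∫ ω, (if sw k ω = true then u else v) ∂P = pr k * u + (1 - pr k) * v := by
  have hm : MeasurableSet {ω | sw k ω = true} := hS.measurable_sw k (measurableSet_singleton true)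
  have hreal : P.real {ω | sw k ω = true} = pr k := by
    rw [Measure.real, hS.prob_sw k hk, ENNReal.toReal_ofReal h0]
  have e : ∀ ω, (if sw k ω = true then u else v) =
      v + {ω | sw k ω = true}.indicator 1 ω * (u - v) := fun ω => by
    by_cases h : sw k ω = true <;> simp [h, Set.indicator]
  have hI : Integrable ({ω | sw k ω = true}.indicator (1 : Ω → ℝ)) P :=
    (integrable_const (1 : ℝ)).indicator hm
  simp_rw [e]
  rw [integral_add (integrable_const _) (hI.mul_const (u - v)), integral_mul_const,
    integral_indicator_one hm, hreal]
  simp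
  ring

end Sampling

/-! ### The error of the loopless SARAH estimator -/

section Estimator

variable {p : ℕ} {Ω Ξ : Type*} [MeasurableSpace Ω] [MeasurableSpace Ξ] {P : Measure Ω}
  [IsProbabilityMeasure P] {D : Measure Ξ} [IsProbabilityMeasure D] {b n : ℕ}
  {Fo : Vec p → Ξ → Vec p} {F : Vec p → Vec p} {T : Vec p → Set (Vec p)}
  {σ L Lhat ρ lam μ r β : ℝ} {x0 xstar : Vec p} {pr : ℕ → ℝ}
  {sw : ℕ → Ω → Bool} {S : ℕ → Fin b → Ω → Ξ} {Sbar : ℕ → Fin n → Ω → Ξ}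

omit [IsProbabilityMeasure D] in
theorem IsProblem.measurable_oracle_apply (hP : IsProblem D Fo F T σ L ρ) (x : Vec p) :
    Measurable (Fo x) :=
  hP.measurable_oracle.comp measurable_prodMk_left

theorem IsProblem.measurable_oracleGap (hP : IsProblem D Fo F T σ L ρ) :
    Measurable fun q : Vec p × Vec p => oracleGap D Fo q.1 q.2 := by
  have h1 : Measurable fun q : (Vec p × Vec p) × Ξ => Fo q.1.1 q.2 :=
    hP.measurable_oracle.comp (f := fun q : (Vec p × Vec p) × Ξ => (q.1.1, q.2)) (by fun_prop)
  have h2 : Measurable fun q : (Vec p × Vec p) × Ξ => Fo q.1.2 q.2 :=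
    hP.measurable_oracle.comp (f := fun q : (Vec p × Vec p) × Ξ => (q.1.2, q.2)) (by fun_prop)
  have h3 : Measurable (Function.uncurry fun (q : Vec p × Vec p) ξ =>
      ‖Fo q.1 ξ - Fo q.2 ξ‖ ^ 2) := (h1.sub h2).norm.pow_const 2
  exact (h3.stronglyMeasurable.integral_prod_right).measurable

/-- The mean-squared error of the mega-batch average at a fixed point. -/
theorem IsProblem.megaBatch_error (hP : IsProblem D Fo F T σ L ρ)
    (hS : IsSampling P D pr sw S Sbar) (hn : 0 < n) (k : ℕ) (x : Vec p) :
    Integrable (fun ω => ‖batchMean Fo (fun j => Sbar k j ω) x - F x‖ ^ 2) P ∧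
    ∫ ω, ‖batchMean Fo (fun j => Sbar k j ω) x - F x‖ ^ 2 ∂P ≤ σ ^ 2 / n := by
  have h := integral_norm_const_add_average_sq hn (hS.measurable_Sbar k) (hS.law_Sbar k)
    (hS.indep_Sbar k) (hP.measurable_oracle_apply x) (hP.memLp_oracle x) 0
  rw [← hP.unbiased x] at h
  simp only [zero_add, norm_zero, ne_eq, OfNat.ofNat_ne_zero, not_false_eq_true, zero_pow] at h
  refine ⟨h.1, h.2.le.trans ?_⟩
  rw [div_eq_inv_mul]
  exact mul_le_mul_of_nonneg_left (hP.variance_le x) (by positivity)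

/-- The mean-squared error of the mini-batch recursion between two fixed points, with incoming
error `c`. -/
theorem IsProblem.miniBatch_error (hP : IsProblem D Fo F T σ L ρ)
    (hS : IsSampling P D pr sw S Sbar) (hb : 0 < b) (k : ℕ) (x x' f : Vec p) :
    Integrable (fun ω => ‖f + batchMean Fo (fun i => S k i ω) x' -
      batchMean Fo (fun i => S k i ω) x - F x'‖ ^ 2) P ∧
    ∫ ω, ‖f + batchMean Fo (fun i => S k i ω) x' -
      batchMean Fo (fun i => S k i ω) x - F x'‖ ^ 2 ∂P ≤
      ‖f - F x‖ ^ 2 + oracleGap D Fo x' x / b := by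
  have hm := (hP.memLp_oracle x').sub (hP.memLp_oracle x)
  have h := integral_norm_const_add_average_sq hb (hS.measurable_S k) (hS.law_S k)
    (hS.indep_S k) ((hP.measurable_oracle_apply x').sub (hP.measurable_oracle_apply x)) hm
    (f - F x)
  have hmean : ∫ ξ, (Fo x' - Fo x) ξ ∂D = F x' - F x := by
    rw [hP.unbiased x, hP.unbiased x']
    exact integral_sub ((hP.memLp_oracle x').integrable (by norm_num))
      ((hP.memLp_oracle x).integrable (by norm_num))
  have hvar := integral_norm_sub_integral_sq hm
  rw [hvar, hmean] at h
  have e : ∀ ω, f + batchMean Fo (fun i => S k i ω) x' - batchMean Fo (fun i => S k i ω) x - F x' =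
      f - F x + ((b : ℝ)⁻¹ • ∑ i, (Fo x' - Fo x) (S k i ω) - (F x' - F x)) := fun ω => by
    simp only [batchMean, Pi.sub_apply, Finset.sum_sub_distrib, smul_sub]
    abel
  simp_rw [e]
  refine ⟨h.1, h.2.le.trans ?_⟩
  rw [div_eq_inv_mul]
  gcongr
  exact sub_le_self _ (by positivity)

/-- The mean-squared error of the next estimator, from a fixed state. -/
theorem IsProblem.nextF_error (hP : IsProblem D Fo F T σ L ρ)
    (hS : IsSampling P D pr sw S Sbar) (hb : 0 < b) (hn : 0 < n) (k : ℕ)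
    (hp0 : 0 ≤ pr (k + 1)) (hp1 : pr (k + 1) ≤ 1) (s : Vec p × Vec p × Vec p) :
    Integrable (fun ω => ‖nextF Fo T lam μ r β k s (noise sw S Sbar (k + 1) ω) -
      F (nextX T lam μ r β k s)‖ ^ 2) P ∧
    ∫ ω, ‖nextF Fo T lam μ r β k s (noise sw S Sbar (k + 1) ω) -
      F (nextX T lam μ r β k s)‖ ^ 2 ∂P ≤
      pr (k + 1) * (σ ^ 2 / n) + (1 - pr (k + 1)) *
        (‖s.2.2 - F s.1‖ ^ 2 + oracleGap D Fo (nextX T lam μ r β k s) s.1 / b) := by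
  set x' := nextX T lam μ r β k s with hx'
  obtain ⟨hA1, hA2⟩ := hP.megaBatch_error hS hn (k + 1) x'
  obtain ⟨hB1, hB2⟩ := hP.miniBatch_error hS hb (k + 1) s.1 x' s.2.2
  let gA : (Fin b → Ξ) × (Fin n → Ξ) → ℝ := fun q => ‖batchMean Fo q.2 x' - F x'‖ ^ 2
  let gB : (Fin b → Ξ) × (Fin n → Ξ) → ℝ := fun q =>
    ‖s.2.2 + batchMean Fo q.1 x' - batchMean Fo q.1 s.1 - F x'‖ ^ 2
  have hbm : ∀ (m : ℕ) (x : Vec p), Measurable fun q : Fin m → Ξ => batchMean Fo q x :=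
    fun m x => (measurable_batchMean hP.measurable_oracle).comp
      (f := fun q : Fin m → Ξ => (q, x)) (by fun_prop)
  have hgA : Measurable gA := (((hbm n x').comp measurable_snd).sub_const _).norm.pow_const 2
  have hgB : Measurable gB :=
    (((((hbm b x').comp measurable_fst).const_add _).sub
      ((hbm b s.1).comp measurable_fst)).sub_const _).norm.pow_const 2
  let u : Bool → ℝ := fun c => if c = true then 1 else 0
  let u' : Bool → ℝ := fun c => if c = true then 0 else 1
  have hindA := (hS.indep_sw (k + 1)).comp (φ := u) (measurable_of_finite u) hgA
  have hindB := (hS.indep_sw (k + 1)).comp (φ := u') (measurable_of_finite u') hgB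
  have hu : Integrable (u ∘ sw (k + 1)) P := by
    refine (integrable_const (1 : ℝ)).mono' ((measurable_of_finite u).comp
      (hS.measurable_sw _)).aestronglyMeasurable (.of_forall fun ω => ?_)
    by_cases h : sw (k + 1) ω = true <;> simp [u, h]
  have hu' : Integrable (u' ∘ sw (k + 1)) P := by
    refine (integrable_const (1 : ℝ)).mono' ((measurable_of_finite u').comp
      (hS.measurable_sw _)).aestronglyMeasurable (.of_forall fun ω => ?_)
    by_cases h : sw (k + 1) ω = true <;> simp [u', h]
  have e : ∀ ω, ‖nextF Fo T lam μ r β k s (noise sw S Sbar (k + 1) ω) - F x'‖ ^ 2 =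
      (u ∘ sw (k + 1)) ω *
        (gA ∘ fun ω => ((fun i => S (k + 1) i ω), (fun j => Sbar (k + 1) j ω))) ω +
      (u' ∘ sw (k + 1)) ω *
        (gB ∘ fun ω => ((fun i => S (k + 1) i ω), (fun j => Sbar (k + 1) j ω))) ω := fun ω => by
    by_cases h : sw (k + 1) ω = true <;> simp [u, u', gA, gB, h, nextF, noise, ← hx']
  simp_rw [e]
  have hiA := hindA.integrable_mul hu hA1
  have hiB := hindB.integrable_mul hu' hB1
  refine ⟨hiA.add hiB, ?_⟩
  have e1 := hindA.integral_fun_mul_eq_mul_integral hu.1 hA1.1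
  have e2 := hindB.integral_fun_mul_eq_mul_integral hu'.1 hB1.1
  have e3 : ∫ ω, (u ∘ sw (k + 1)) ω ∂P = pr (k + 1) := by
    have := hS.integral_sw (k := k + 1) (by omega) hp0 1 0
    simpa [u] using this
  have e4 : ∫ ω, (u' ∘ sw (k + 1)) ω ∂P = 1 - pr (k + 1) := by
    have := hS.integral_sw (k := k + 1) (by omega) hp0 0 1
    simpa [u'] using this
  rw [e3] at e1
  rw [e4] at e2
  refine (integral_add hiA hiB).trans_le ((congrArg₂ (· + ·) e1 e2).trans_le ?_)
  exact add_le_add (mul_le_mul_of_nonneg_left hA2 hp0)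
    (mul_le_mul_of_nonneg_left hB2 (by linarith))

omit [IsProbabilityMeasure P] in
theorem IsProblem.oracleGap_integrable (hP : IsProblem D Fo F T σ L ρ) {x y : Ω → Vec p}
    (hx : MemLp x 2 P) (hy : MemLp y 2 P) (hxm : Measurable x) (hym : Measurable y) :
    Integrable (fun ω => oracleGap D Fo (x ω) (y ω)) P := by
  refine ((integrable_norm_sq (hx.sub hy)).const_mul (L ^ 2)).mono'
    (hP.measurable_oracleGap.comp (hxm.prodMk hym)).aestronglyMeasurable (.of_forall fun ω => ?_)
  rw [Real.norm_of_nonneg (oracleGap_nonneg _ _ _ _)]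
  exact hP.oracleGap_le _ _

/-- The error recursion of the loopless SARAH estimator. -/
theorem IsProblem.estimator_error_succ (hP : IsProblem D Fo F T σ L ρ)
    (hA : AdmissibleParams L Lhat ρ lam μ r β) (hS : IsSampling P D pr sw S Sbar)
    (hb : 0 < b) (hn : 0 < n) (k : ℕ) (hp0 : 0 ≤ pr (k + 1)) (hp1 : pr (k + 1) ≤ 1)
    (hx : MemLp (fun ω => (path Fo T lam μ r β x0 sw S Sbar k ω).1) 2 P)
    (hx' : MemLp (fun ω => (path Fo T lam μ r β x0 sw S Sbar (k + 1) ω).1) 2 P)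
    (he : MemLp (fun ω => (path Fo T lam μ r β x0 sw S Sbar k ω).2.2 -
      F (path Fo T lam μ r β x0 sw S Sbar k ω).1) 2 P) :
    MemLp (fun ω => (path Fo T lam μ r β x0 sw S Sbar (k + 1) ω).2.2 -
      F (path Fo T lam μ r β x0 sw S Sbar (k + 1) ω).1) 2 P ∧
    ∫ ω, ‖(path Fo T lam μ r β x0 sw S Sbar (k + 1) ω).2.2 -
      F (path Fo T lam μ r β x0 sw S Sbar (k + 1) ω).1‖ ^ 2 ∂P ≤
      pr (k + 1) * (σ ^ 2 / n) + (1 - pr (k + 1)) *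
        (∫ ω, ‖(path Fo T lam μ r β x0 sw S Sbar k ω).2.2 -
          F (path Fo T lam μ r β x0 sw S Sbar k ω).1‖ ^ 2 ∂P +
        (∫ ω, oracleGap D Fo (path Fo T lam μ r β x0 sw S Sbar (k + 1) ω).1
          (path Fo T lam μ r β x0 sw S Sbar k ω).1 ∂P) / b) := by
  have hm := hP.measurable_path hA (x0 := x0) hS k
  have hm' := hP.measurable_path hA (x0 := x0) hS (k + 1)
  have hFm := hP.continuous.measurable
  have hnx := hP.measurable_nextX hA k
  have hgm := hP.measurable_oracleGap
  have hgap := hP.oracleGap_integrable hx' hx hm'.fst hm.fst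
  have hsq := integrable_norm_sq he
  have hem : AEStronglyMeasurable (fun ω => (path Fo T lam μ r β x0 sw S Sbar (k + 1) ω).2.2 -
      F (path Fo T lam μ r β x0 sw S Sbar (k + 1) ω).1) P :=
    (hm'.snd.snd.sub (hFm.comp hm'.fst)).aestronglyMeasurable
  have hind := hP.indepFun_path_noise hA (x0 := x0) hS k
  have hinner := hP.nextF_error (T := T) (lam := lam) (μ := μ) (r := r) (β := β)
    hS hb hn k hp0 hp1
  have hφ : Measurable (Function.uncurry fun (s : Vec p × Vec p × Vec p)
      (q : Bool × (Fin b → Ξ) × (Fin n → Ξ)) =>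
      ‖nextF Fo T lam μ r β k s q - F (nextX T lam μ r β k s)‖ ^ 2) :=
    ((hP.measurable_nextF hA k).sub (hFm.comp (hnx.comp measurable_fst))).norm.pow_const 2
  have hψ : Measurable fun s : Vec p × Vec p × Vec p =>
      pr (k + 1) * (σ ^ 2 / n) + (1 - pr (k + 1)) *
        (‖s.2.2 - F s.1‖ ^ 2 + oracleGap D Fo (nextX T lam μ r β k s) s.1 / b) := by
    have h1 : Measurable fun s : Vec p × Vec p × Vec p =>
        oracleGap D Fo (nextX T lam μ r β k s) s.1 :=
      hgm.comp (f := fun s : Vec p × Vec p × Vec p => (nextX T lam μ r β k s, s.1))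
        (hnx.prodMk measurable_fst)
    have h2 : Measurable fun s : Vec p × Vec p × Vec p => ‖s.2.2 - F s.1‖ ^ 2 :=
      (measurable_snd.snd.sub (hFm.comp measurable_fst)).norm.pow_const 2
    exact ((h2.add (h1.div_const _)).const_mul _).const_add _
  simp only [path_succ] at hem hgap ⊢
  generalize path Fo T lam μ r β x0 sw S Sbar k = X at *
  have hnoise := hS.measurable_noise (k + 1)
  generalize noise sw S Sbar (k + 1) = Z at *
  have hsum := hsq.add (hgap.div_const (b : ℝ))
  have hψi : Integrable (fun ω => pr (k + 1) * (σ ^ 2 / n) + (1 - pr (k + 1)) *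
        (‖(X ω).2.2 - F (X ω).1‖ ^ 2 +
          oracleGap D Fo (nextX T lam μ r β k (X ω)) (X ω).1 / b)) P :=
    (integrable_const _).add (hsum.const_mul _)
  have main := IndepFun.integral_le_of_forall hind hm hnoise hφ (fun _ _ => sq_nonneg _) hψ hψi
    hinner
  refine ⟨(memLp_two_iff_integrable_sq_norm hem).2 main.1, main.2.trans_eq ?_⟩
  · have e2 : ∫ ω, (‖(X ω).2.2 - F (X ω).1‖ ^ 2 +
        oracleGap D Fo (nextX T lam μ r β k (X ω)) (X ω).1 / b) ∂P = _ :=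
      integral_add hsq (hgap.div_const (b : ℝ))
    have e1 : ∫ ω, (pr (k + 1) * (σ ^ 2 / n) + (1 - pr (k + 1)) *
        (‖(X ω).2.2 - F (X ω).1‖ ^ 2 +
          oracleGap D Fo (nextX T lam μ r β k (X ω)) (X ω).1 / b)) ∂P = _ :=
      integral_add (integrable_const _) (hsum.const_mul (1 - pr (k + 1)))
    refine e1.trans ?_
    have e3 := integral_const_mul (μ := P) (1 - pr (k + 1)) (fun ω => ‖(X ω).2.2 - F (X ω).1‖ ^ 2 +
        oracleGap D Fo (nextX T lam μ r β k (X ω)) (X ω).1 / b)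
    refine congrArg₂ (· + ·) (by simp) (e3.trans ?_)
    rw [e2, integral_div]

end Estimator

/-! ### The expected Lyapunov inequality -/

section Expected

variable {p : ℕ} {Ω Ξ : Type*} [MeasurableSpace Ω] [MeasurableSpace Ξ] {P : Measure Ω}
  [IsProbabilityMeasure P] {D : Measure Ξ} [IsProbabilityMeasure D] {b n : ℕ}
  {Fo : Vec p → Ξ → Vec p} {F : Vec p → Vec p} {T : Vec p → Set (Vec p)}
  {σ L Lhat ρ lam μ r β : ℝ} {x0 xstar : Vec p} {pr : ℕ → ℝ}
  {sw : ℕ → Ω → Bool} {S : ℕ → Fin b → Ω → Ξ} {Sbar : ℕ → Fin n → Ω → Ξ}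

theorem IsProblem.le_inner_G (hP : IsProblem D Fo F T σ L ρ)
    (hA : AdmissibleParams L Lhat ρ lam μ r β) (hx : xstar ∈ zer F T) (x : Vec p) :
    betaBar Lhat ρ lam * ‖G F T lam x‖ ^ 2 ≤ inner ℝ (G F T lam x) (x - xstar) := by
  have h := hP.G_cocoercive hA x xstar
  rw [hP.G_eq_zero hA hx, sub_zero] at h
  have := mul_nonneg (hP.Lam_pos hA).le (oracleGap_nonneg D Fo x xstar)
  linarith

theorem IsProblem.norm_G_le (hP : IsProblem D Fo F T σ L ρ)
    (hA : AdmissibleParams L Lhat ρ lam μ r β) (hx : xstar ∈ zer F T) (x : Vec p) :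
    ‖G F T lam x‖ ≤ β⁻¹ * ‖x - xstar‖ := by
  have h := hP.le_inner_G hA hx x
  have h1 := real_inner_le_norm (G F T lam x) (x - xstar)
  have h2 := mul_le_mul_of_nonneg_right hA.beta_le_betaBar (sq_nonneg ‖G F T lam x‖)
  have hβ := hA.beta_pos
  rw [inv_mul_eq_div, le_div_iff₀ hβ]
  by_contra! hlt
  rcases (norm_nonneg (G F T lam x)).eq_or_lt with h0 | h0
  · rw [← h0, zero_mul] at hlt
    exact absurd hlt (norm_nonneg _).not_gt
  · nlinarith

theorem IsProblem.continuous_G (hP : IsProblem D Fo F T σ L ρ)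
    (hA : AdmissibleParams L Lhat ρ lam μ r β) : Continuous (G F T lam) :=
  (hP.continuous_residual hA).comp (continuous_id.prodMk hP.continuous)

theorem IsProblem.memLp_G (hP : IsProblem D Fo F T σ L ρ)
    (hA : AdmissibleParams L Lhat ρ lam μ r β) (hx : xstar ∈ zer F T) {x : Ω → Vec p}
    (h : MemLp x 2 P) : MemLp (fun ω => G F T lam (x ω)) 2 P :=
  (h.sub (memLp_const xstar)).of_le_mul
    ((hP.continuous_G hA).comp_aestronglyMeasurable h.1) (.of_forall fun _ => hP.norm_G_le hA hx _)

/-- All iterates and all estimation errors are square integrable. -/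
theorem IsProblem.memLp_path (hP : IsProblem D Fo F T σ L ρ)
    (hA : AdmissibleParams L Lhat ρ lam μ r β) (hx : xstar ∈ zer F T)
    (hS : IsSampling P D pr sw S Sbar) (hb : 0 < b) (hn : 0 < n)
    (hp0 : ∀ k, 0 ≤ pr (k + 1)) (hp1 : ∀ k, pr (k + 1) ≤ 1) (k : ℕ) :
    MemLp (fun ω => (path Fo T lam μ r β x0 sw S Sbar k ω).1) 2 P ∧
    MemLp (fun ω => (path Fo T lam μ r β x0 sw S Sbar k ω).2.1) 2 P ∧
    MemLp (fun ω => (path Fo T lam μ r β x0 sw S Sbar k ω).2.2 -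
      F (path Fo T lam μ r β x0 sw S Sbar k ω).1) 2 P := by
  induction k with
  | zero =>
    refine ⟨memLp_const x0, memLp_const x0, ?_⟩
    refine (memLp_two_iff_integrable_sq_norm ?_).2 (hP.megaBatch_error hS hn 0 x0).1
    have hm := hP.measurable_path hA (x0 := x0) hS 0
    exact (hm.snd.snd.sub (hP.continuous.measurable.comp hm.fst)).aestronglyMeasurable
  | succ k ih =>
    obtain ⟨h1, h2, h3⟩ := ih
    have hm := hP.measurable_path hA (x0 := x0) hS k
    have hG := hP.memLp_G hA hx h1
    have hres : MemLp (fun ω => residual T lam (path Fo T lam μ r β x0 sw S Sbar k ω).1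
        (path Fo T lam μ r β x0 sw S Sbar k ω).2.2) 2 P := by
      have hrm : AEStronglyMeasurable (fun ω =>
          residual T lam (path Fo T lam μ r β x0 sw S Sbar k ω).1
            (path Fo T lam μ r β x0 sw S Sbar k ω).2.2) P :=
        ((hP.continuous_residual hA).measurable.comp
          (f := fun ω => ((path Fo T lam μ r β x0 sw S Sbar k ω).1,
            (path Fo T lam μ r β x0 sw S Sbar k ω).2.2))
          (hm.fst.prodMk hm.snd.snd)).aestronglyMeasurable
      have hd : MemLp (fun ω => residual T lam (path Fo T lam μ r β x0 sw S Sbar k ω).1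
          (path Fo T lam μ r β x0 sw S Sbar k ω).2.2 -
          G F T lam (path Fo T lam μ r β x0 sw S Sbar k ω).1) 2 P :=
        h3.of_le (hrm.sub hG.1) (.of_forall fun ω => hP.norm_residual_sub_le hA _ _)
      refine (hd.add hG).ae_eq (.of_forall fun ω => ?_)
      simp
    have h1' : MemLp (fun ω => (path Fo T lam μ r β x0 sw S Sbar (k + 1) ω).1) 2 P := by
      simp only [path_succ]
      exact ((h1.const_smul ((tSeq μ r k - 1) / tSeq μ r k)).add
        (h2.const_smul (1 / tSeq μ r k))).sub (hres.const_smul (etaSeq μ r β k))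
    refine ⟨h1', ?_, (hP.estimator_error_succ hA hS hb hn k (hp0 k) (hp1 k) h1 h1' h3).1⟩
    simp only [path_succ]
    exact h2.sub (hres.const_smul (μ / 2 * etaSeq μ r β k))

omit [IsProbabilityMeasure P] in
theorem integrable_lyap [IsFiniteMeasure P] {ν τ : ℝ} {g x z : Ω → Vec p} (hg : MemLp g 2 P)
    (hx : MemLp x 2 P) (hz : MemLp z 2 P) (xs : Vec p) :
    Integrable (fun ω => lyap ν β τ xs (g ω) (x ω) (z ω)) P :=
  ((((integrable_norm_sq hg).const_mul _).add
    ((integrable_inner_of_memLp hg (hx.sub hz)).const_mul _)).add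
    ((integrable_norm_sq (hx.sub hz)).const_mul _)).add
    ((integrable_norm_sq (hz.sub (memLp_const xs))).const_mul _)

theorem AdmissibleParams.lt_mul_r (hA : AdmissibleParams L Lhat ρ lam μ r β) :
    1 + 3 * μ < μ * r := by
  have h1 := hA.mu_pos
  have h2 := mul_lt_mul_of_pos_left hA.r_gt h1
  rw [mul_add, mul_one_div_cancel h1.ne'] at h2
  linarith

theorem AdmissibleParams.lt_tSeq (hA : AdmissibleParams L Lhat ρ lam μ r β) (k : ℕ) :
    1 + 3 * μ < tSeq μ r k := by
  have h1 := mul_nonneg hA.mu_pos.le k.cast_nonneg (α := ℝ)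
  have h2 := hA.lt_mul_r
  unfold tSeq
  linarith

/-- One step of the method decreases the Lyapunov function along every sample path, up to the
squared estimation error. -/
theorem IsProblem.lyap_path_succ (hP : IsProblem D Fo F T σ L ρ)
    (hA : AdmissibleParams L Lhat ρ lam μ r β) (hx : xstar ∈ zer F T) (k : ℕ)
    (s : Vec p × Vec p × Vec p) :
    lyap (μ / 2) β (tSeq μ r k) xstar (G F T lam (nextX T lam μ r β k s)) (nextX T lam μ r β k s)
        (nextZ T lam μ r β k s) +
      tSeq μ r k * (tSeq μ r k - 1) * (Lam L Lhat * oracleGap D Fo (nextX T lam μ r β k s) s.1) ≤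
    lyap (μ / 2) β (tSeq μ r k - μ) xstar (G F T lam s.1) s.1 s.2.1 +
      5 * β / (2 * μ) * (tSeq μ r k * (tSeq μ r k - 1)) * ‖s.2.2 - F s.1‖ ^ 2 := by
  have hμ := hA.mu_pos
  have hμ' := hA.mu_lt
  have hβ := hA.beta_pos
  have ht := hA.lt_tSeq k
  have hres : G F T lam s.1 + (residual T lam s.1 s.2.2 - G F T lam s.1) =
      residual T lam s.1 s.2.2 := by abel
  have h := lyap_step (ν := μ / 2) (β := β) (bb := betaBar Lhat ρ lam) (t := tSeq μ r k)
    (LU := Lam L Lhat * oracleGap D Fo (nextX T lam μ r β k s) s.1) (xs := xstar)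
    (g := G F T lam s.1) (g' := G F T lam (nextX T lam μ r β k s))
    (e := residual T lam s.1 s.2.2 - G F T lam s.1) (x := s.1) (z := s.2.1)
    (x' := nextX T lam μ r β k s) (z' := nextZ T lam μ r β k s) (by linarith) (by linarith)
    hβ (by linarith) hA.le_betaBar (by rw [hres]; rfl) (by rw [hres]; rfl)
    (hP.G_cocoercive hA _ _) (hP.le_inner_G hA hx _)
  have e1 : 2 * (μ / 2) = μ := by ring
  have e2 : 5 * β / (4 * (μ / 2)) = 5 * β / (2 * μ) := by congr 1; ring
  rw [e1, e2] at h
  refine h.trans ?_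
  have h3 : 0 ≤ 5 * β / (2 * μ) * (tSeq μ r k * (tSeq μ r k - 1)) := by
    have : 0 < tSeq μ r k - 1 := by linarith
    have : 0 < tSeq μ r k := by linarith
    positivity
  gcongr
  exact hP.norm_residual_sub_le hA _ _

theorem tSeq_succ_sub (μ r : ℝ) (k : ℕ) : tSeq μ r (k + 1) - μ = tSeq μ r k := by
  unfold tSeq
  push_cast
  ring

/-- The Lyapunov inequality in expectation. -/
theorem IsProblem.integral_lyap_succ (hP : IsProblem D Fo F T σ L ρ)
    (hA : AdmissibleParams L Lhat ρ lam μ r β) (hx : xstar ∈ zer F T)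
    (hS : IsSampling P D pr sw S Sbar) (hb : 0 < b) (hn : 0 < n)
    (hp0 : ∀ k, 0 ≤ pr (k + 1)) (hp1 : ∀ k, pr (k + 1) ≤ 1) (k : ℕ) :
    ∫ ω, lyap (μ / 2) β (tSeq μ r (k + 1) - μ) xstar
        (G F T lam (path Fo T lam μ r β x0 sw S Sbar (k + 1) ω).1)
        (path Fo T lam μ r β x0 sw S Sbar (k + 1) ω).1
        (path Fo T lam μ r β x0 sw S Sbar (k + 1) ω).2.1 ∂P +
      tSeq μ r k * (tSeq μ r k - 1) * (Lam L Lhat *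
        ∫ ω, oracleGap D Fo (path Fo T lam μ r β x0 sw S Sbar (k + 1) ω).1
          (path Fo T lam μ r β x0 sw S Sbar k ω).1 ∂P) ≤
    ∫ ω, lyap (μ / 2) β (tSeq μ r k - μ) xstar
        (G F T lam (path Fo T lam μ r β x0 sw S Sbar k ω).1)
        (path Fo T lam μ r β x0 sw S Sbar k ω).1
        (path Fo T lam μ r β x0 sw S Sbar k ω).2.1 ∂P +
      5 * β / (2 * μ) * (tSeq μ r k * (tSeq μ r k - 1)) *
        ∫ ω, ‖(path Fo T lam μ r β x0 sw S Sbar k ω).2.2 -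
          F (path Fo T lam μ r β x0 sw S Sbar k ω).1‖ ^ 2 ∂P := by
  obtain ⟨h1, h2, h3⟩ := hP.memLp_path hA hx (x0 := x0) hS hb hn hp0 hp1 k
  obtain ⟨h1', h2', -⟩ := hP.memLp_path hA hx (x0 := x0) hS hb hn hp0 hp1 (k + 1)
  have hm := hP.measurable_path hA (x0 := x0) hS k
  have hm' := hP.measurable_path hA (x0 := x0) hS (k + 1)
  have hgap := hP.oracleGap_integrable h1' h1 hm'.fst hm.fst
  have hV := integrable_lyap (ν := μ / 2) (β := β) (τ := tSeq μ r k - μ) (hP.memLp_G hA hx h1)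
    h1 h2 xstar
  have hV' := integrable_lyap (ν := μ / 2) (β := β) (τ := tSeq μ r (k + 1) - μ)
    (hP.memLp_G hA hx h1') h1' h2' xstar
  have he := integrable_norm_sq h3
  rw [← integral_const_mul, ← integral_const_mul, ← integral_const_mul,
    ← integral_add hV' ((hgap.const_mul _).const_mul _), ← integral_add hV (he.const_mul _)]
  refine integral_mono (hV'.add ((hgap.const_mul _).const_mul _)) (hV.add (he.const_mul _))
    fun ω => ?_
  have := hP.lyap_path_succ hA hx k (path Fo T lam μ r β x0 sw S Sbar k ω)
  simp only [path_succ, tSeq_succ_sub]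
  exact this

/-- The Lyapunov function at the initial point. -/
theorem AdmissibleParams.lyap_zero_le (hA : AdmissibleParams L Lhat ρ lam μ r β) :
    lyap (μ / 2) β (tSeq μ r 0 - μ) xstar (G F T lam x0) x0 x0 ≤
      3 / 2 * β * Psi0 F T lam μ r β x0 xstar ^ 2 := by
  have hμ := hA.mu_pos
  have hμ' := hA.mu_lt
  have hβ := hA.beta_pos
  have hr := hA.lt_mul_r
  have hr' : 1 < r := by
    have := hA.r_gt
    have : 0 < 1 / μ := by positivity
    linarith
  have h1 : 0 < μ * r - 1 := by linarith
  have h2 : 0 < μ * r - μ - 1 := by linarith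
  have h3 : 0 < μ * r - μ - μ / 2 := by linarith
  have h4 : 0 < 2 * r - 1 := by linarith
  have ht0 : tSeq μ r 0 = μ * r := by simp [tSeq]
  have hΨ : Psi0 F T lam μ r β x0 xstar ^ 2 = μ ^ 2 * r ^ 2 * ‖G F T lam x0‖ ^ 2 +
      (2 * r - 1) / (4 * β ^ 2 * (μ * r - 1)) * ‖x0 - xstar‖ ^ 2 := by
    unfold Psi0
    rw [Real.sq_sqrt]
    positivity
  rw [hΨ, ht0]
  unfold lyap
  rw [sub_self, inner_zero_right, norm_zero]
  have c1 : β * ((μ * r - μ) * (μ * r - μ - 1)) ≤ 3 / 2 * β * (μ ^ 2 * r ^ 2) := by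
    have : (μ * r - μ) * (μ * r - μ - 1) ≤ (μ * r) * (μ * r) :=
      mul_le_mul (by linarith) (by linarith) h2.le (by linarith)
    nlinarith [mul_pos hβ (mul_pos (by linarith : 0 < μ * r) (by linarith : 0 < μ * r))]
  have c2 : (μ * r - μ - μ / 2) / (4 * (μ / 2) * β * (μ * r - μ - 1)) ≤
      3 / 2 * β * ((2 * r - 1) / (4 * β ^ 2 * (μ * r - 1))) := by
    have e1 : (μ * r - μ - μ / 2) / (4 * (μ / 2) * β * (μ * r - μ - 1)) =
        1 / (2 * μ * β) * ((μ * r - μ - μ / 2) / (μ * r - μ - 1)) := by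
      field_simp
      ring
    have e2 : 3 / 2 * β * ((2 * r - 1) / (4 * β ^ 2 * (μ * r - 1))) =
        1 / (2 * μ * β) * (3 / 2 * (μ * r - μ / 2) / (μ * r - 1)) := by
      field_simp
      ring
    rw [e1, e2]
    gcongr ?_ * ?_
    rw [div_le_div_iff₀ h2 h1]
    nlinarith
  nlinarith [mul_le_mul_of_nonneg_right c1 (sq_nonneg ‖G F T lam x0‖),
    mul_le_mul_of_nonneg_right c2 (sq_nonneg ‖x0 - xstar‖)]

end Expected

/-! ### Parameters, rate and complexity -/

section Sequences

variable {L Lhat ρ lam μ r β ε : ℝ}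

theorem AdmissibleParams.switchProb_bounds (hA : AdmissibleParams L Lhat ρ lam μ r β)
    (hε : 0 < ε) (hε' : ε ≤ (μ * (r - 3) - 1) / (μ * (r - 1) - 1)) (k : ℕ) :
    0 ≤ switchProb μ r ε (k + 1) ∧ switchProb μ r ε (k + 1) ≤ 1 := by
  have hμ := hA.mu_pos
  have hr := hA.lt_mul_r
  have hk := mul_nonneg hμ.le (k.cast_nonneg (α := ℝ))
  have h1 : 0 < μ * (r - 1) - 1 := by linarith
  have h2 : 0 < μ * (((k + 1 : ℕ) : ℝ) + r - 1) - 1 := by push_cast; linarith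
  have h3 : 2 * μ / (μ * (((k + 1 : ℕ) : ℝ) + r - 1) - 1) ≤ 2 * μ / (μ * (r - 1) - 1) := by
    gcongr
    push_cast
    linarith
  have h4 : (μ * (r - 3) - 1) / (μ * (r - 1) - 1) = 1 - 2 * μ / (μ * (r - 1) - 1) := by
    rw [eq_sub_iff_add_eq, ← add_div, div_eq_one_iff_eq h1.ne']
    ring
  unfold switchProb
  exact ⟨by positivity, by linarith⟩

theorem AdmissibleParams.eps_lt_one (hA : AdmissibleParams L Lhat ρ lam μ r β)
    (hε' : ε ≤ (μ * (r - 3) - 1) / (μ * (r - 1) - 1)) : ε < 1 := by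
  have hμ := hA.mu_pos
  have hr := hA.lt_mul_r
  refine hε'.trans_lt ?_
  rw [div_lt_one (by linarith)]
  linarith

theorem half_le_max_one_floor (x : ℝ) : x / 2 ≤ ((max 1 ⌊x⌋₊ : ℕ) : ℝ) := by
  push_cast
  rcases le_total x 2 with h | h
  · exact le_max_of_le_left (by linarith)
  · refine le_max_of_le_right ?_
    have := Nat.lt_floor_add_one x
    linarith

theorem max_one_floor_le {x : ℝ} (hx : 0 ≤ x) : ((max 1 ⌊x⌋₊ : ℕ) : ℝ) ≤ 1 + x := by
  push_cast
  exact max_le (by linarith) ((Nat.floor_le hx).trans (by linarith))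

/-- Eliminating the estimation errors `Δ` from the Lyapunov inequality. A mega-batch never adds
more than `v` to the error, so only the excess `d` of `Δ` over `v` is put into the Lyapunov
function, with a weight proportional to `(t_k - μ) (t_k - μ - 1)`. The part `2 μ / (t_k - 1)` of the
switching probability makes up for the growth of this weight, and the part `ε` for the error term
in the Lyapunov inequality. -/
theorem AdmissibleParams.lyap_sum_le (hA : AdmissibleParams L Lhat ρ lam μ r β)
    (hε : 0 < ε) (hε' : ε ≤ (μ * (r - 3) - 1) / (μ * (r - 1) - 1)) {V Δ U : ℕ → ℝ} {v Λ B : ℝ}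
    (hB : 0 < B) (hU : ∀ k, 0 ≤ U k) (hBΛ : 5 * β / (2 * μ * ε) / B ≤ Λ)
    (hV : ∀ k, V (k + 1) + tSeq μ r k * (tSeq μ r k - 1) * (Λ * U k) ≤
      V k + 5 * β / (2 * μ) * (tSeq μ r k * (tSeq μ r k - 1)) * Δ k)
    (hΔ0 : Δ 0 ≤ v)
    (hΔ : ∀ k, Δ (k + 1) ≤ switchProb μ r ε (k + 1) * v +
      (1 - switchProb μ r ε (k + 1)) * (Δ k + U k / B)) (K : ℕ) :
    V K ≤ V 0 + 5 * β / (2 * μ) * v *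
      ∑ k ∈ Finset.range K, tSeq μ r k * (tSeq μ r k - 1) := by
  have hμ := hA.mu_pos
  have hβ := hA.beta_pos
  set c := 5 * β / (2 * μ) with hc
  have hc0 : 0 < c := by positivity
  suffices h : ∃ d, 0 ≤ d ∧ Δ K ≤ v + d ∧
      V K + c / ε * ((tSeq μ r K - μ) * (tSeq μ r K - μ - 1)) * d ≤ V 0 + c * v *
        ∑ k ∈ Finset.range K, tSeq μ r k * (tSeq μ r k - 1) by
    obtain ⟨d, hd, -, h⟩ := h
    have ht := hA.lt_tSeq K
    have h1 : 0 < tSeq μ r K - μ := by linarith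
    have h2 : 0 < tSeq μ r K - μ - 1 := by linarith
    have : 0 ≤ c / ε * ((tSeq μ r K - μ) * (tSeq μ r K - μ - 1)) * d := by positivity
    linarith
  induction K with
  | zero => exact ⟨0, le_rfl, by simpa using hΔ0, by simp⟩
  | succ k ih =>
    obtain ⟨d, hd, hΔd, hVd⟩ := ih
    obtain ⟨hp0, hp1⟩ := hA.switchProb_bounds hε hε' k
    have hp : switchProb μ r ε (k + 1) = ε + 2 * μ / (tSeq μ r k - 1) := by
      unfold switchProb tSeq
      push_cast
      congr 3
      ring
    set q := switchProb μ r ε (k + 1) with hq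
    have ht := hA.lt_tSeq k
    have hΔk := hΔ k
    have hVk := hV k
    rw [tSeq_succ_sub, Finset.sum_range_succ]
    set t := tSeq μ r k
    have ht1 : 0 < t - 1 := by linarith
    have ht0 : 0 < t := by linarith
    set h := t * (t - 1) with hh
    have hh0 : 0 < h := by positivity
    have hUk := hU k
    refine ⟨(1 - q) * (d + U k / B), mul_nonneg (by linarith) (by positivity), ?_, ?_⟩
    · refine hΔk.trans ?_
      have := mul_le_mul_of_nonneg_left (add_le_add_left hΔd (U k / B))
        (by linarith : 0 ≤ 1 - q)
      linarith
    · have h1 : c / ε * h * ((1 - q) * (U k / B)) ≤ h * (Λ * U k) := by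
        have e1 : c / ε * h * ((1 - q) * (U k / B)) =
            h * (c / ε / B * U k) * (1 - q) := by ring
        have e2 : c / ε / B = 5 * β / (2 * μ * ε) / B := by rw [hc, div_div (5 * β)]
        rw [e1, e2]
        calc _ ≤ h * (5 * β / (2 * μ * ε) / B * U k) * 1 := by
              gcongr
              linarith
          _ ≤ _ := by rw [mul_one]; gcongr
      have h2 : h * (1 - q) + ε * h ≤ (t - μ) * (t - μ - 1) := by
        have : h * (1 - q) + ε * h = t * (t - 1 - 2 * μ) := by
          rw [hp, hh]
          field_simp
          ring
        rw [this]
        nlinarith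
      have h3 : c / ε * h * ((1 - q) * d) + c * h * d ≤
          c / ε * ((t - μ) * (t - μ - 1)) * d := by
        have e1 : c / ε * h * ((1 - q) * d) + c * h * d =
            c / ε * (h * (1 - q) + ε * h) * d := by
          field_simp
        rw [e1]
        gcongr
      have h4 : c * h * Δ k ≤ c * h * (v + d) := by gcongr
      have e3 : c / ε * h * ((1 - q) * (d + U k / B)) =
          c / ε * h * ((1 - q) * d) + c / ε * h * ((1 - q) * (U k / B)) := by ring
      have e4 : t * (t - 1) = h := rfl
      rw [e3]
      linarith

theorem AdmissibleParams.sum_tSeq_le (hA : AdmissibleParams L Lhat ρ lam μ r β) (K : ℕ) :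
    3 * ∑ k ∈ Finset.range K, tSeq μ r k * (tSeq μ r k - 1) ≤ μ ^ 2 * (K + r - 1) ^ 3 := by
  have hμ := hA.mu_pos
  have hμ' := hA.mu_lt
  have hr := hA.lt_mul_r
  have hr1 : 1 < r := by
    have := hA.r_gt
    have : 0 < 1 / μ := by positivity
    linarith
  induction K with
  | zero =>
    have : 0 < r - 1 := by linarith
    simp only [Finset.range_zero, Finset.sum_empty, mul_zero, Nat.cast_zero, zero_add]
    positivity
  | succ k ih =>
    rw [Finset.sum_range_succ, mul_add]
    have hx : 0 < (k : ℝ) + r := by have := k.cast_nonneg (α := ℝ); linarith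
    push_cast
    unfold tSeq at ih ⊢
    have e : (k : ℝ) + 1 + r - 1 = k + r := by ring
    rw [e]
    generalize (k : ℝ) + r = x at *
    nlinarith [mul_pos hμ hx, mul_nonneg (mul_pos hμ hx).le (by linarith : 0 ≤ 1 - 3 / 2 * μ)]

end Sequences

section Final

variable {p : ℕ} {Ω Ξ : Type*} [MeasurableSpace Ω] [MeasurableSpace Ξ] {P : Measure Ω}
  [IsProbabilityMeasure P] {D : Measure Ξ} [IsProbabilityMeasure D] {b n : ℕ}
  {Fo : Vec p → Ξ → Vec p} {F : Vec p → Vec p} {T : Vec p → Set (Vec p)}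
  {σ L Lhat ρ lam μ r β ε : ℝ} {x0 xstar : Vec p}
  {sw : ℕ → Ω → Bool} {S : ℕ → Fin b → Ω → Ξ} {Sbar : ℕ → Fin n → Ω → Ξ}

/-- The rate of the method: an `O(1 / K²)` term from the initial point and a term `O(K σ² / n)`
from the mega-batches. -/
theorem IsProblem.integral_norm_G_sq_le (hP : IsProblem D Fo F T σ L ρ)
    (hA : AdmissibleParams L Lhat ρ lam μ r β) (hx : xstar ∈ zer F T)
    (hε : 0 < ε) (hε' : ε ≤ (μ * (r - 3) - 1) / (μ * (r - 1) - 1))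
    (hb : b = miniBatchSize μ β (Lam L Lhat) ε) (hn : 0 < n)
    (hS : IsSampling P D (switchProb μ r ε) sw S Sbar) (K : ℕ) :
    2 / 3 * β * (μ * (K + r - 1)) ^ 2 *
      ∫ ω, ‖G F T lam (path Fo T lam μ r β x0 sw S Sbar K ω).1‖ ^ 2 ∂P ≤
    3 / 2 * β * Psi0 F T lam μ r β x0 xstar ^ 2 + 5 * β / (2 * μ) * (σ ^ 2 / n) *
      ∑ k ∈ Finset.range K, tSeq μ r k * (tSeq μ r k - 1) := by
  have hμ := hA.mu_pos
  have hμ' := hA.mu_lt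
  have hβ := hA.beta_pos
  have hΛ := hP.Lam_pos hA
  have hp := hA.switchProb_bounds hε hε'
  have hb0 : 0 < b := by rw [hb]; exact Nat.lt_of_lt_of_le one_pos (le_max_left _ _)
  have hBΛ : 5 * β / (2 * μ * ε) / b ≤ Lam L Lhat := by
    have h1 := half_le_max_one_floor (cb μ β (Lam L Lhat) / ε)
    change _ ≤ ((miniBatchSize μ β (Lam L Lhat) ε : ℕ) : ℝ) at h1
    rw [← hb] at h1
    have h2 : 5 * β / (2 * μ * ε) = Lam L Lhat * (cb μ β (Lam L Lhat) / ε / 2) := by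
      unfold cb
      field_simp
    rw [div_le_iff₀ (by positivity), h2]
    gcongr
  have hmem := hP.memLp_path hA hx (x0 := x0) hS hb0 hn (fun k => (hp k).1) (fun k => (hp k).2)
  have main := hA.lyap_sum_le hε hε' (B := b) (v := σ ^ 2 / n) (by positivity)
    (U := fun k => ∫ ω, oracleGap D Fo (path Fo T lam μ r β x0 sw S Sbar (k + 1) ω).1
      (path Fo T lam μ r β x0 sw S Sbar k ω).1 ∂P)
    (Δ := fun k => ∫ ω, ‖(path Fo T lam μ r β x0 sw S Sbar k ω).2.2 -
      F (path Fo T lam μ r β x0 sw S Sbar k ω).1‖ ^ 2 ∂P)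
    (V := fun k => ∫ ω, lyap (μ / 2) β (tSeq μ r k - μ) xstar
      (G F T lam (path Fo T lam μ r β x0 sw S Sbar k ω).1)
      (path Fo T lam μ r β x0 sw S Sbar k ω).1
      (path Fo T lam μ r β x0 sw S Sbar k ω).2.1 ∂P)
    (fun k => integral_nonneg fun _ => oracleGap_nonneg _ _ _ _) hBΛ
    (hP.integral_lyap_succ hA hx (x0 := x0) hS hb0 hn (fun k => (hp k).1) (fun k => (hp k).2))
    (hP.megaBatch_error hS hn 0 x0).2
    (fun k => (hP.estimator_error_succ hA hS hb0 hn k (hp k).1 (hp k).2 (hmem k).1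
      (hmem (k + 1)).1 (hmem k).2.2).2) K
  have h0 : ∫ ω, lyap (μ / 2) β (tSeq μ r 0 - μ) xstar
      (G F T lam (path Fo T lam μ r β x0 sw S Sbar 0 ω).1)
      (path Fo T lam μ r β x0 sw S Sbar 0 ω).1
      (path Fo T lam μ r β x0 sw S Sbar 0 ω).2.1 ∂P ≤
      3 / 2 * β * Psi0 F T lam μ r β x0 xstar ^ 2 := by
    change ∫ ω, lyap (μ / 2) β (tSeq μ r 0 - μ) xstar (G F T lam x0) x0 x0 ∂P ≤ _
    rw [integral_const]
    simpa using hA.lyap_zero_le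
  obtain ⟨h1, h2, -⟩ := hmem K
  have hG := hP.memLp_G hA hx h1
  have hlow : 2 / 3 * β * (μ * (K + r - 1)) ^ 2 *
      ∫ ω, ‖G F T lam (path Fo T lam μ r β x0 sw S Sbar K ω).1‖ ^ 2 ∂P ≤
      ∫ ω, lyap (μ / 2) β (tSeq μ r K - μ) xstar
      (G F T lam (path Fo T lam μ r β x0 sw S Sbar K ω).1)
      (path Fo T lam μ r β x0 sw S Sbar K ω).1
      (path Fo T lam μ r β x0 sw S Sbar K ω).2.1 ∂P := by
    rw [← integral_const_mul]
    refine integral_mono ((integrable_norm_sq hG).const_mul _) (integrable_lyap hG h1 h2 xstar)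
      fun ω => ?_
    have e : tSeq μ r K - μ = μ * (K + r - 1) := by unfold tSeq; ring
    have ht := hA.lt_tSeq K
    have := le_lyap (ν := μ / 2) (β := β) (τ := tSeq μ r K - μ) (by linarith) (by linarith)
      hβ (by linarith) (path Fo T lam μ r β x0 sw S Sbar K ω).2.1
      ((mul_le_mul_of_nonneg_right hA.beta_le_betaBar (sq_nonneg _)).trans (hP.le_inner_G hA hx
        (path Fo T lam μ r β x0 sw S Sbar K ω).1))
    rw [e] at this ⊢
    exact this
  linarith

omit [IsProbabilityMeasure D] in
/-- The expected number of calls in the iterations `0, …, K`. -/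
theorem IsSampling.integral_totalCalls_le (hS : IsSampling P D (switchProb μ r ε) sw S Sbar)
    (hp : ∀ k, 0 ≤ switchProb μ r ε (k + 1)) (K : ℕ) :
    ∫ ω, (totalCalls b n (fun k => sw k ω) K : ℝ) ∂P ≤
      n * (1 + ∑ k ∈ Finset.range K, switchProb μ r ε (k + 1)) + (2 * b + 1) * K + 1 := by
  have hi : ∀ (k : ℕ) (u v : ℝ), Integrable (fun ω => if sw k ω = true then u else v) P := by
    intro k u v
    refine (integrable_const (max |u| |v|)).mono' ((measurable_of_finite
      (fun c : Bool => if c = true then u else v)).comp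
      (hS.measurable_sw k)).aestronglyMeasurable (.of_forall fun ω => ?_)
    by_cases h : sw k ω = true <;> simp [h]
  have hi1 : ∀ k : ℕ, Integrable (fun ω => (if sw (k + 1) ω = true then (n : ℝ) else 2 * b) + 1) P :=
    fun k => (hi _ _ _).add (integrable_const _)
  have hone : ∀ (k : ℕ) (ω : Ω), ((oracleCalls b n (fun k => sw k ω) (k + 1) + 1 : ℕ) : ℝ) =
      (if sw (k + 1) ω = true then (n : ℝ) else 2 * b) + 1 := by
    intro k ω
    by_cases h : sw (k + 1) ω = true <;> simp [oracleCalls, h]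
  have e : ∀ ω, (totalCalls b n (fun k => sw k ω) K : ℝ) =
      ∑ k ∈ Finset.range K, ((if sw (k + 1) ω = true then (n : ℝ) else 2 * b) + 1) + (n + 1) := by
    intro ω
    rw [totalCalls, Finset.sum_range_succ']
    push_cast [← hone]
    simp [oracleCalls]
  simp_rw [e]
  rw [integral_add (integrable_finsetSum _ fun k _ => hi1 k) (integrable_const _),
    integral_finsetSum _ fun k _ => hi1 k]
  have hterm : ∀ k ∈ Finset.range K,
      ∫ ω, ((if sw (k + 1) ω = true then (n : ℝ) else 2 * b) + 1) ∂P ≤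
        n * switchProb μ r ε (k + 1) + (2 * b + 1) := by
    intro k _
    rw [integral_add (hi _ _ _) (integrable_const _), hS.integral_sw (by omega) (hp k)]
    have := mul_nonneg (hp k) (by positivity : (0 : ℝ) ≤ 2 * b)
    simp
    linarith
  have := Finset.sum_le_sum hterm
  rw [Finset.sum_add_distrib, ← Finset.mul_sum] at this
  simp only [Finset.sum_const, Finset.card_range, nsmul_eq_mul] at this
  simp only [integral_const, probReal_univ, smul_eq_mul, one_mul]
  linarith

theorem AdmissibleParams.sum_switchProb_le (hA : AdmissibleParams L Lhat ρ lam μ r β) (K : ℕ) :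
    ∑ k ∈ Finset.range K, switchProb μ r ε (k + 1) ≤ ε * K + 2 * (1 + Real.log K) := by
  have hμ := hA.mu_pos
  have hr := hA.lt_mul_r
  have h1 : ∀ k ∈ Finset.range K, switchProb μ r ε (k + 1) ≤ ε + 2 * ((k : ℝ) + 1)⁻¹ := by
    intro k _
    have hk := k.cast_nonneg (α := ℝ)
    have h2 : 0 < μ * (((k + 1 : ℕ) : ℝ) + r - 1) - 1 := by push_cast; nlinarith
    unfold switchProb
    gcongr
    rw [← div_eq_mul_inv, div_le_div_iff₀ h2 (by positivity)]
    push_cast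
    nlinarith
  refine (Finset.sum_le_sum h1).trans ?_
  have h2 := harmonic_le_one_add_log K
  rw [harmonic] at h2
  push_cast at h2
  rw [Finset.sum_add_distrib, ← Finset.mul_sum]
  simp only [Finset.sum_const, Finset.card_range, nsmul_eq_mul]
  linarith

/-- The constant of the complexity bound, as a function of `μ`, `r`, `β`, `Λ`, `σ` and `Ψ₀`; `r`
does not enter. -/
noncomputable def complexityConst (μ _r β Λ σ Ψ : ℝ) : ℝ :=
  (1 + cn μ β σ Ψ) * (2 * Ψ / μ + 5 + 2 * Real.log (2 * Ψ / μ + 1)) +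
    (3 + 2 * cb μ β Λ) * (2 * Ψ / μ) + 1

theorem complexity_le (hμ : 0 < μ) (hβ : 0 < β) {Λ Ψ : ℝ} (hΛ : 0 < Λ) (hΨ : 0 ≤ Ψ)
    (hε : 0 < ε) (hε1 : ε < 1) {K : ℕ} (hK : K ≤ 2 * Ψ / (μ * ε)) {q : ℝ}
    (hq : q ≤ ε * K + 2 * (1 + Real.log K)) :
    (megaBatchSize μ β σ Ψ ε : ℝ) * (1 + q) + (2 * miniBatchSize μ β Λ ε + 1) * K + 1 ≤
      complexityConst μ r β Λ σ Ψ * (1 / ε ^ 2 + 1 / ε ^ 3 + 1 / ε ^ 3 * Real.log (1 / ε)) := by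
  have hcb : 0 ≤ cb μ β Λ := by unfold cb; positivity
  have hcn : 0 ≤ cn μ β σ Ψ := by
    unfold cn
    have : 0 ≤ max (√2 * Ψ / μ ^ 2) (1 / (μ * β)) := le_max_of_le_right (by positivity)
    positivity
  have hn : (megaBatchSize μ β σ Ψ ε : ℝ) ≤ (1 + cn μ β σ Ψ) * (1 / ε ^ 3) := by
    have h1 := max_one_floor_le (x := cn μ β σ Ψ / ε ^ 3) (by positivity)
    have h2 : 1 ≤ 1 / ε ^ 3 := by
      rw [le_div_iff₀ (by positivity), one_mul]
      exact pow_le_one₀ hε.le hε1.le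
    calc _ ≤ 1 + cn μ β σ Ψ / ε ^ 3 := h1
      _ ≤ 1 / ε ^ 3 + cn μ β σ Ψ / ε ^ 3 := by gcongr
      _ = _ := by ring
  have h1ε : 1 ≤ 1 / ε := by rw [le_div_iff₀ hε]; linarith
  have hb : (miniBatchSize μ β Λ ε : ℝ) ≤ (1 + cb μ β Λ) * (1 / ε) := by
    have h1 := max_one_floor_le (x := cb μ β Λ / ε) (by positivity)
    calc _ ≤ 1 + cb μ β Λ / ε := h1
      _ ≤ 1 / ε + cb μ β Λ / ε := by gcongr
      _ = _ := by ring
  set A := 2 * Ψ / μ with hA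
  have hA0 : 0 ≤ A := by positivity
  have hK' : (K : ℝ) ≤ A * (1 / ε) := by
    refine hK.trans_eq ?_
    rw [hA]
    field_simp
  have hLg : 0 ≤ Real.log (1 / ε) := Real.log_nonneg h1ε
  have hLA : 0 ≤ Real.log (A + 1) := Real.log_nonneg (by linarith)
  have hlogK : Real.log K ≤ Real.log (A + 1) + Real.log (1 / ε) := by
    rcases Nat.eq_zero_or_pos K with h0 | h0
    · simp only [h0, Nat.cast_zero, Real.log_zero]
      positivity
    · rw [← Real.log_mul (by positivity) (by positivity)]
      refine Real.log_le_log (by exact_mod_cast h0) (hK'.trans ?_)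
      gcongr
      linarith
  have hεK : ε * K ≤ A := by
    calc ε * K ≤ ε * (A * (1 / ε)) := by gcongr
      _ = A := by field_simp
  have hq' : 1 + q ≤ (A + 3 + 2 * Real.log (A + 1)) + 2 * Real.log (1 / ε) := by linarith
  have t1 : (megaBatchSize μ β σ Ψ ε : ℝ) * (1 + q) ≤ (1 + cn μ β σ Ψ) * (1 / ε ^ 3) *
      ((A + 3 + 2 * Real.log (A + 1)) + 2 * Real.log (1 / ε)) := by
    refine (mul_le_mul_of_nonneg_left hq' (Nat.cast_nonneg _)).trans ?_
    gcongr
  have t2 : (2 * (miniBatchSize μ β Λ ε : ℝ) + 1) * K ≤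
      (3 + 2 * cb μ β Λ) * A * (1 / ε ^ 2) := by
    calc (2 * (miniBatchSize μ β Λ ε : ℝ) + 1) * K
        ≤ (2 * ((1 + cb μ β Λ) * (1 / ε)) + 1 / ε) * (A * (1 / ε)) := by gcongr
      _ = _ := by field_simp; ring
  have t3 : 1 ≤ 1 / ε ^ 2 := by
    rw [le_div_iff₀ (by positivity), one_mul]
    exact pow_le_one₀ hε.le hε1.le
  have hE2 : 0 < 1 / ε ^ 2 := by positivity
  have hE3 : 0 < 1 / ε ^ 3 := by positivity
  unfold complexityConst
  rw [← hA]
  generalize 1 / ε ^ 2 = E2 at *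
  generalize 1 / ε ^ 3 = E3 at *
  generalize Real.log (1 / ε) = Lg at *
  generalize Real.log (A + 1) = LA at *
  set a := 1 + cn μ β σ Ψ with ha
  have ha0 : 0 < a := by positivity
  set d := (3 + 2 * cb μ β Λ) * A with hd
  have hd0 : 0 ≤ d := by positivity
  have hM : 0 ≤ a * (A + 5 + 2 * LA) := by positivity
  have p1 : a * E3 * (A + 3 + 2 * LA) ≤ (a * (A + 5 + 2 * LA) + d + 1) * E3 := by
    have : a * (A + 3 + 2 * LA) ≤ a * (A + 5 + 2 * LA) + d + 1 := by nlinarith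
    nlinarith
  have p2 : a * E3 * (2 * Lg) ≤ (a * (A + 5 + 2 * LA) + d + 1) * (E3 * Lg) := by
    have h1 : a * 2 ≤ a * (A + 5 + 2 * LA) + d + 1 := by nlinarith
    have h2 := mul_le_mul_of_nonneg_right h1 (mul_nonneg hE3.le hLg)
    linarith
  have p3 : d * E2 + 1 ≤ (a * (A + 5 + 2 * LA) + d + 1) * E2 := by
    nlinarith [mul_nonneg hM hE2.le]
  linarith

end Final

end VFOSA

theorem mainTheorem11 :
    ∃ C : (μ r β Λ σ Ψ : ℝ) → ℝ,
      ∀ (p : ℕ) (Ξ : Type*) [MeasurableSpace Ξ] (D : Measure Ξ) [IsProbabilityMeasure D]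
        (Fo : VFOSA.Vec p → Ξ → VFOSA.Vec p) (F : VFOSA.Vec p → VFOSA.Vec p)
        (T : VFOSA.Vec p → Set (VFOSA.Vec p)) (σ L Lhat ρ lam μ r β : ℝ)
        (x0 xstar : VFOSA.Vec p),
        VFOSA.IsProblem D Fo F T σ L ρ →
        VFOSA.AdmissibleParams L Lhat ρ lam μ r β →
        (T x0).Nonempty →
        xstar ∈ VFOSA.zer F T →
        ∀ (Λ Ψ : ℝ), Λ = VFOSA.Lam L Lhat → Ψ = VFOSA.Psi0 F T lam μ r β x0 xstar →
        ∀ ε : ℝ, 0 < ε → ε ≤ (μ * (r - 3) - 1) / (μ * (r - 1) - 1) →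
        ∀ (b n : ℕ), b = VFOSA.miniBatchSize μ β Λ ε → n = VFOSA.megaBatchSize μ β σ Ψ ε →
        ∀ (Ω : Type*) [MeasurableSpace Ω] (P : Measure Ω) [IsProbabilityMeasure P]
          (sw : ℕ → Ω → Bool) (S : ℕ → Fin b → Ω → Ξ) (Sbar : ℕ → Fin n → Ω → Ξ),
          VFOSA.IsSampling P D (VFOSA.switchProb μ r ε) sw S Sbar →
          ∃ K : ℕ,
            Integrable (fun ω => ‖VFOSA.G F T lam
              (VFOSA.run Fo T lam μ r β x0 (fun k => sw k ω) (fun k i => S k i ω)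
                (fun k j => Sbar k j ω) K).x‖ ^ 2) P ∧
            ∫ ω, ‖VFOSA.G F T lam
              (VFOSA.run Fo T lam μ r β x0 (fun k => sw k ω) (fun k i => S k i ω)
                (fun k j => Sbar k j ω) K).x‖ ^ 2 ∂P ≤ ε ^ 2 ∧
            ∫ ω, (VFOSA.totalCalls b n (fun k => sw k ω) K : ℝ) ∂P ≤
              C μ r β Λ σ Ψ * (1 / ε ^ 2 + 1 / ε ^ 3 + 1 / ε ^ 3 * Real.log (1 / ε)) := by
  refine ⟨VFOSA.complexityConst, ?_⟩
  intro p Ξ _ D _ Fo F T σ L Lhat ρ lam μ r β x0 xstar hP hA _ hx Λ Ψ hΛ hΨ ε hε hε' b n hb hn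
    Ω _ P _ sw S Sbar hS
  have hμ := hA.mu_pos
  have hβ := hA.beta_pos
  have hΛ0 : 0 < Λ := hΛ ▸ hP.Lam_pos hA
  have hΨ0 : 0 ≤ Ψ := hΨ ▸ Real.sqrt_nonneg _
  have hε1 := hA.eps_lt_one hε'
  have hp := hA.switchProb_bounds hε hε'
  have hb0 : 0 < b := by rw [hb]; exact Nat.lt_of_lt_of_le one_pos (le_max_left _ _)
  have hn0 : 0 < n := by rw [hn]; exact Nat.lt_of_lt_of_le one_pos (le_max_left _ _)
  have hr : 7 / 2 < r - 1 := by
    have h1 := hA.r_gt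
    have h2 : 3 / 2 < 1 / μ := by
      rw [lt_div_iff₀ hμ]; linarith [hA.mu_lt]
    linarith
  set X := 2 * Ψ / (μ * ε) with hX
  have hX0 : 0 ≤ X := by positivity
  have hXε : μ * X * ε = 2 * Ψ := by rw [hX]; field_simp
  -- The mega-batches are so large that their error `v` satisfies `v Ψ ≤ μ² ε³ / 16`.
  have hv : σ ^ 2 / n * Ψ ≤ μ ^ 2 * ε ^ 3 / 16 := by
    have h1 := VFOSA.half_le_max_one_floor (VFOSA.cn μ β σ Ψ / ε ^ 3)
    change _ ≤ ((VFOSA.megaBatchSize μ β σ Ψ ε : ℕ) : ℝ) at h1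
    rw [← hn] at h1
    have h2 : 24 * σ ^ 2 * (√2 * Ψ / μ ^ 2) ≤ VFOSA.cn μ β σ Ψ := by
      unfold VFOSA.cn
      gcongr
      exact le_max_left _ _
    have h3 : (4 / 3 : ℝ) ≤ √2 := by
      apply Real.le_sqrt_of_sq_le
      norm_num
    have h4 : 24 * σ ^ 2 * (4 / 3 * Ψ / μ ^ 2) ≤ 24 * σ ^ 2 * (√2 * Ψ / μ ^ 2) := by gcongr
    have h5 : 24 * σ ^ 2 * (4 / 3 * Ψ / μ ^ 2) ≤ 2 * n * ε ^ 3 := by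
      rw [div_div, div_le_iff₀ (by positivity)] at h1
      linarith
    rw [div_mul_eq_mul_div, div_le_iff₀ (by positivity)]
    have e : 24 * σ ^ 2 * (4 / 3 * Ψ / μ ^ 2) = 32 * (σ ^ 2 * Ψ) / μ ^ 2 := by ring
    rw [e, div_le_iff₀ (by positivity)] at h5
    linarith
  have hmem := hP.memLp_path hA hx (x0 := x0) hS hb0 hn0 (fun k => (hp k).1) (fun k => (hp k).2)
  have hrate := hP.integral_norm_G_sq_le hA hx (x0 := x0) hε hε' (hΛ ▸ hb) hn0 hS
  rw [← hΨ] at hrate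
  -- The first `K` with `2 Ψ ≤ μ ε (K + r - 1)`.
  set K := ⌈X - (r - 1)⌉₊ with hK
  have hXK : X ≤ K + r - 1 := by
    have := Nat.le_ceil (X - (r - 1))
    rw [← hK] at this
    linarith
  have hKX : (K : ℝ) ≤ X := by
    rcases le_total X (r - 1) with h | h
    · have : K = 0 := by rw [hK, Nat.ceil_eq_zero]; linarith
      rw [this]; simpa using hX0
    · have := Nat.ceil_lt_add_one (sub_nonneg.2 h)
      rw [← hK] at this
      linarith
  refine ⟨K, VFOSA.integrable_norm_sq (hP.memLp_G hA hx (hmem K).1), ?_, ?_⟩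
  · change ∫ ω, ‖VFOSA.G F T lam (VFOSA.path Fo T lam μ r β x0 sw S Sbar K ω).1‖ ^ 2 ∂P ≤ ε ^ 2
    have hKr := hrate K
    generalize ∫ ω, ‖VFOSA.G F T lam (VFOSA.path Fo T lam μ r β x0 sw S Sbar K ω).1‖ ^ 2 ∂P = I
      at *
    set N := (K : ℝ) + r - 1 with hN
    have hN0 : 0 < N := by have := K.cast_nonneg (α := ℝ); linarith
    have hΨN : 4 * Ψ ^ 2 ≤ (μ * N) ^ 2 * ε ^ 2 := by
      have h1 : 2 * Ψ ≤ μ * N * ε := by rw [← hXε]; gcongr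
      have h2 := mul_self_le_mul_self (by positivity) h1
      linarith
    have hsum : 5 * β / (2 * μ) * (σ ^ 2 / n) *
        ∑ k ∈ Finset.range K, VFOSA.tSeq μ r k * (VFOSA.tSeq μ r k - 1) ≤
        β * ((μ * N) ^ 2 * ε ^ 2) * (5 / 24) := by
      rcases Nat.eq_zero_or_pos K with h0 | h0
      · rw [h0, Finset.sum_range_zero, mul_zero]
        positivity
      · have h1 : r - 1 < X := by
          have := Nat.ceil_pos.1 (hK ▸ h0)
          linarith
        have h2 : N ≤ 2 * X := by
          have := Nat.ceil_lt_add_one (sub_nonneg.2 h1.le)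
          rw [← hK] at this
          linarith
        have h3 := hA.sum_tSeq_le K
        rw [← hN] at h3
        have h4 : σ ^ 2 / n * N ≤ μ * ε ^ 2 / 4 := by
          have h5 : σ ^ 2 / n * N ≤ σ ^ 2 / n * (2 * X) := by gcongr
          have h6 : σ ^ 2 / n * (2 * X) = 4 * (σ ^ 2 / n * Ψ) / (μ * ε) := by
            rw [hX]; ring
          refine h5.trans (h6.trans_le ?_)
          rw [div_le_iff₀ (by positivity)]
          linarith
        calc _ ≤ 5 * β / (2 * μ) * (σ ^ 2 / n) * (μ ^ 2 * N ^ 3 / 3) := by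
              gcongr
              linarith
          _ = 5 * β * μ / 6 * N ^ 2 * (σ ^ 2 / n * N) := by field_simp; ring
          _ ≤ 5 * β * μ / 6 * N ^ 2 * (μ * ε ^ 2 / 4) := by gcongr
          _ = _ := by ring
    have hfin : 2 / 3 * β * (μ * N) ^ 2 * I ≤ 2 / 3 * β * (μ * N) ^ 2 * ε ^ 2 := by
      have h1 := mul_le_mul_of_nonneg_left hΨN hβ.le
      have h2 : 0 ≤ β * ((μ * N) ^ 2 * ε ^ 2) := by positivity
      linarith
    exact le_of_mul_le_mul_left hfin (by positivity)
  · refine (hS.integral_totalCalls_le (fun k => (hp k).1) K).trans ?_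
    rw [hn, hb]
    exact VFOSA.complexity_le hμ hβ hΛ0 hΨ0 hε hε1 hKX (hA.sum_switchProb_le K)
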